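/- **Setting.** Let $\pi\colon E\to M$ be a smooth bundle with $\dim M=m\ge 1$ and $\dim E=m+n$ (it suffices that $\pi$ is a surjection and that $E$ has an atlas of charts $(x^i,u^\alpha)$ in which $(x^i)$ is a smooth chart of $M$ composed with $\pi$). Let $\Lambda^m_2(T^*E)$ (respectively $\Lambda^m_1(T^*E)$) be the bundle over $E$ of those $m$-covectors of $E$ that vanish whenever two (respectively one) of their arguments are $\pi$-vertical. Put $J^1\pi^*=\Lambda^m_2(T^*E)/\Lambda^m_1(T^*E)$, with the quotient map $\mu\colon\Lambda^m_2(T^*E)\to J^1\pi^*$ and the projections $\pi_E^r\colon J^1\pi^*\to E$ and $\bar\pi_E^r=\pi\circ\pi_E^r\colon J^1\pi^*\to M$. Let $\Theta$ be the tautological (Liouville) $m$-form on $\Lambda^m_2(T^*E)$, let $h\colon J^1\pi^*\to\Lambda^m_2(T^*E)$ be a Hamiltonian section, i.e. a smooth section of $\mu$, and put $\Omega_h=-\mathrm d(h^*\Theta)$. For a distribution $D$ on the total space of $f\colon P\to M$, an integral section of $D$ over $N\subseteq M$ is a smooth section $\sigma$ of $f$ on an open neighbourhood of $N$ with $\operatorname{Im}(T_x\sigma)=D_{\sigma(x)}$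 for all $x$ there (only its restriction to $N$ matters). A distribution transverse to $f$ is called integrable if an integral section passes through each point of $P$. Let $\mathcal D_h$ be a solution of the Hamiltonian problem: a smooth, rank-$m$, integrable distribution on $J^1\pi^*$, transverse to $\bar\pi_E^r$, all of whose (local) integral sections $\psi$ satisfy $\psi^*(i(X)\Omega_h)=0$ for every smooth vector field $X$ on $J^1\pi^*$. For a smooth section $s$ of $\pi_E^r$ let $\mathcal D=T\pi_E^r(\mathcal D_h|_{\operatorname{Im}(s)})$ be the distribution $\mathcal D_u=T_{s(u)}\pi_E^r(\mathcal D_{h,s(u)})$ on $E$. * $s$ *solves the generalized Hamiltonian Hamilton–Jacobi problem* if $\mathcal D$ is integrable and $s\circ\gamma$ is an integral section of $\mathcal D_h$ for every integral section $\gamma$ of $\mathcal D$ over an open subset of $M$. It *solves the Hamiltonian Hamilton–Jacobi problem* if, moreover, $s^*\Omega_h=0$. * $\operatorname{Im}(s)$ is *$m$-Lagrangian* if at each of its points its tangent space $F$ equals $F^{\perp,m}=\{w : \Omega_h(w,v_1,\dots,v_m)=0\ \text{for all } v_1,\dots,v_m\in F\}$. $\mathcal D_h$ is *tangent* to $\operatorname{Im}(s)$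 if $\mathcal D_{h,s(u)}\subseteq T_{s(u)}\operatorname{Im}(s)$ for all $u\in E$. * A *domain with boundary* is a connected set $N\subseteq M$ with $\partial N:=N\setminus\operatorname{int}N\neq\emptyset$ that near each point $x$ of $\partial N$ has the form $\{g\le 0\}$ with $g$ smooth, $g(x)=0$ and $\mathrm d g(x)\neq 0$. An integral section $\psi$ of $\mathcal D_h$ over $N$ has *boundary conditions in $\operatorname{Im}(s)$* if $\psi(\partial N)\subseteq\operatorname{Im}(s)$. **Proposition.** Let $s$ be a smooth section of $\pi_E^r$ with $s^*\Omega_h=0$. The following are equivalent: 1. $s$ solves the Hamiltonian Hamilton–Jacobi problem. 2. $\operatorname{Im}(s)$ is $m$-Lagrangian for $\Omega_h$ and $\mathcal D_h$ is tangent to it. 3. The distribution $\mathcal D$ is integrable, and the integral sections of $\mathcal D_h$ with boundary conditions in $\operatorname{Im}(s)$ project onto the integral sections of $\mathcal D$: for every domain $N$ with boundary, $\pi_E^r\circ\psi$ is an integral section of $\mathcal D$ over $N$ whenever $\psi$ is an integral section of $\mathcal D_h$ over $N$ with boundary conditions in $\operatorname{Im}(s)$, and every integral section of $\mathcal D$ over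 $N$ agrees on $N$ with $\pi_E^r\circ\psi$ for some such $\psi$. -/

import Mathlib

open scoped Manifold ContDiff Topology
open Set

namespace HJ

noncomputable section

/-! ### Linear algebra of the model fibres -/

/-- Model of the base manifold, `ℝᵐ` (coordinates `xⁱ`). -/
abbrev BaseModel (m : ℕ) : Type := EuclideanSpace ℝ (Fin m)

/-- Model of the fibres, `ℝⁿ` (coordinates `uᵅ`). -/
abbrev FibreModel (n : ℕ) : Type := EuclideanSpace ℝ (Fin n)

/-- Model of the total space of a bundle with adapted coordinates `(xⁱ, uᵅ)`.
The vertical vectors of the model are those with vanishing first component. -/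
abbrev TotModel (m n : ℕ) : Type := BaseModel m × FibreModel n

/-- The alternating `m`-forms which vanish when two of their arguments are vertical
(the model fibre of `Λᵐ₂(T*E)`). -/
def semibasicTwo (m n : ℕ) : Submodule ℝ ((TotModel m n) [⋀^Fin m]→L[ℝ] ℝ) where
  carrier := {τ | ∀ (v : Fin m → TotModel m n) (i j : Fin m), i ≠ j →
    (v i).1 = 0 → (v j).1 = 0 → τ v = 0}
  add_mem' := by
    intro a b ha hb v i j hij hi hj
    simp [ha v i j hij hi hj, hb v i j hij hi hj]
  zero_mem' := by
    intro v i j _ _ _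
    simp
  smul_mem' := by
    intro c a ha v i j hij hi hj
    simp [ha v i j hij hi hj]

/-- Model fibre of the extended dual jet bundle: the space `semibasicTwo`. -/
def ExtFibre (m n : ℕ) : Type := semibasicTwo m n

instance normedAddCommGroup_extFibre (m n : ℕ) : NormedAddCommGroup (ExtFibre m n) :=
  Submodule.normedAddCommGroup (semibasicTwo m n)

instance normedSpace_extFibre (m n : ℕ) : NormedSpace ℝ (ExtFibre m n) :=
  Submodule.normedSpace (semibasicTwo m n)

/-- The inclusion of `semibasicTwo` in the space of all alternating `m`-forms. -/
def inclForm (m n : ℕ) : ExtFibre m n →ₗᵢ[ℝ] (TotModel m n) [⋀^Fin m]→L[ℝ] ℝ :=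
  (semibasicTwo m n).subtypeₗᵢ

/-- The alternating `m`-forms which vanish when one of their arguments is vertical
(the model fibre of `Λᵐ₁(T*E)`), as a subspace of `semibasicTwo`. -/
def semibasicOne (m n : ℕ) : Submodule ℝ (ExtFibre m n) where
  carrier := {τ | ∀ (v : Fin m → TotModel m n) (i : Fin m), (v i).1 = 0 → inclForm m n τ v = 0}
  add_mem' := by
    intro a b ha hb v i hi
    simp [ha v i hi, hb v i hi]
  zero_mem' := by
    intro v i _
    simp
  smul_mem' := by
    intro c a ha v i hi
    simp [ha v i hi]

instance isClosed_semibasicOne (m n : ℕ) :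
    IsClosed (semibasicOne m n : Set (ExtFibre m n)) := by
  have : (semibasicOne m n : Set (ExtFibre m n)) =
      ⋂ (v : Fin m → TotModel m n) (i : Fin m) (_ : (v i).1 = 0),
        {τ : ExtFibre m n | inclForm m n τ v = 0} := by
    ext τ
    simp only [mem_iInter]
    rfl
  rw [this]
  refine isClosed_iInter fun v => isClosed_iInter fun i => isClosed_iInter fun _ => ?_
  refine isClosed_eq ?_ continuous_const
  exact (ContinuousAlternatingMap.apply ℝ (TotModel m n) ℝ v).continuous.comp
    (inclForm m n).continuous

/-- Model fibre of the restricted (reduced) dual jet bundle: `Λᵐ₂ / Λᵐ₁`. -/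
def ResFibre (m n : ℕ) : Type := ExtFibre m n ⧸ semibasicOne m n

instance normedAddCommGroup_resFibre (m n : ℕ) : NormedAddCommGroup (ResFibre m n) :=
  Submodule.Quotient.normedAddCommGroup (semibasicOne m n)

instance normedSpace_resFibre (m n : ℕ) : NormedSpace ℝ (ResFibre m n) :=
  Submodule.Quotient.normedSpace (semibasicOne m n) ℝ

/-- The quotient map `Λᵐ₂ → Λᵐ₂ / Λᵐ₁` of the model fibres. -/
def resMk (m n : ℕ) : ExtFibre m n →L[ℝ] ResFibre m n :=
  Submodule.mkQL (semibasicOne m n)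

theorem resMk_surjective (m n : ℕ) : Function.Surjective (resMk m n) :=
  Submodule.Quotient.mk_surjective (semibasicOne m n)

variable {m n : ℕ}

/-- A linear map of the model which maps vertical vectors to vertical vectors. -/
def PreservesVertical (A : TotModel m n →L[ℝ] TotModel m n) : Prop :=
  ∀ v : FibreModel n, (A (0, v)).1 = 0

/-- Replace by zero the block of `A` which maps vertical to horizontal directions. This does nothing
to maps that preserve vertical vectors (`lowerTri_eq`), which are the only ones that matter. -/
def lowerTri : (TotModel m n →L[ℝ] TotModel m n) →L[ℝ] (TotModel m n →L[ℝ] TotModel m n) :=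
  ContinuousLinearMap.id ℝ _ -
    (ContinuousLinearMap.compL ℝ (TotModel m n) (BaseModel m) (TotModel m n)
        (ContinuousLinearMap.inl ℝ (BaseModel m) (FibreModel n))).comp
      ((ContinuousLinearMap.compL ℝ (TotModel m n) (TotModel m n) (BaseModel m)
          (ContinuousLinearMap.fst ℝ (BaseModel m) (FibreModel n))).comp
        ((ContinuousLinearMap.compL ℝ (TotModel m n) (TotModel m n) (TotModel m n)).flip
          ((ContinuousLinearMap.inr ℝ (BaseModel m) (FibreModel n)).comp
            (ContinuousLinearMap.snd ℝ (BaseModel m) (FibreModel n)))))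

theorem lowerTri_apply (A : TotModel m n →L[ℝ] TotModel m n) (w : TotModel m n) :
    lowerTri A w = A w - ((A (0, w.2)).1, 0) := by
  simp [lowerTri]

theorem lowerTri_vertical (A : TotModel m n →L[ℝ] TotModel m n) {w : TotModel m n}
    (hw : w.1 = 0) : (lowerTri A w).1 = 0 := by
  obtain ⟨x, v⟩ := w
  simp only at hw
  subst hw
  simp [lowerTri_apply]

theorem lowerTri_eq {A : TotModel m n →L[ℝ] TotModel m n} (hA : PreservesVertical A) :
    lowerTri A = A := by
  refine ContinuousLinearMap.ext fun w => ?_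
  rw [lowerTri_apply, hA w.2]
  simp

/-- Pull-back of forms in `Λᵐ₂` by a vertical-preserving linear map. -/
def pullExt (A : TotModel m n →L[ℝ] TotModel m n) : ExtFibre m n →L[ℝ] ExtFibre m n :=
  ((ContinuousAlternatingMap.compContinuousLinearMapCLM (lowerTri A)).comp
    (inclForm m n).toContinuousLinearMap).codRestrict (semibasicTwo m n) (by
      intro τ v i j hij hi hj
      exact τ.2 _ i j hij (lowerTri_vertical A hi) (lowerTri_vertical A hj))

theorem pullExt_coe (A : TotModel m n →L[ℝ] TotModel m n) (τ : ExtFibre m n) :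
    inclForm m n (pullExt A τ) = (inclForm m n τ).compContinuousLinearMap (lowerTri A) := rfl

theorem pullExt_mem_one (A : TotModel m n →L[ℝ] TotModel m n) (τ : ExtFibre m n)
    (hτ : τ ∈ semibasicOne m n) : pullExt A τ ∈ semibasicOne m n := by
  intro v i hi
  exact hτ _ i (lowerTri_vertical A hi)

/-- The induced map on classes in `Λᵐ₂ / Λᵐ₁`. -/
def pullRes (A : TotModel m n →L[ℝ] TotModel m n) : ResFibre m n →L[ℝ] ResFibre m n :=
  Submodule.liftQL (semibasicOne m n) ((resMk m n).comp (pullExt A)) (by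
    intro τ hτ
    exact (Submodule.Quotient.mk_eq_zero (semibasicOne m n)).2 (pullExt_mem_one A τ hτ))

theorem pullRes_mk (A : TotModel m n →L[ℝ] TotModel m n) (τ : ExtFibre m n) :
    pullRes A (resMk m n τ) = resMk m n (pullExt A τ) := rfl

theorem pullExt_id : pullExt (ContinuousLinearMap.id ℝ (TotModel m n)) =
    ContinuousLinearMap.id ℝ (ExtFibre m n) := by
  have h : PreservesVertical (ContinuousLinearMap.id ℝ (TotModel m n)) := fun v => rfl
  refine ContinuousLinearMap.ext fun τ => (inclForm m n).injective ?_
  rw [pullExt_coe, lowerTri_eq h]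
  rfl

theorem pullExt_comp {A B : TotModel m n →L[ℝ] TotModel m n} (hA : PreservesVertical A)
    (hB : PreservesVertical B) : (pullExt A).comp (pullExt B) = pullExt (B.comp A) := by
  have hBA : PreservesVertical (B.comp A) := by
    intro v
    have h : A (0, v) = (0, (A (0, v)).2) := Prod.ext (hA v) rfl
    rw [ContinuousLinearMap.comp_apply, h]
    exact hB _
  refine ContinuousLinearMap.ext fun τ => (inclForm m n).injective ?_
  rw [ContinuousLinearMap.comp_apply, pullExt_coe, pullExt_coe, pullExt_coe, lowerTri_eq hA,
    lowerTri_eq hB, lowerTri_eq hBA]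
  rfl

theorem pullRes_id : pullRes (ContinuousLinearMap.id ℝ (TotModel m n)) =
    ContinuousLinearMap.id ℝ (ResFibre m n) := by
  refine ContinuousLinearMap.ext fun q => ?_
  obtain ⟨τ, rfl⟩ := resMk_surjective m n q
  rw [pullRes_mk, pullExt_id]
  rfl

theorem pullRes_comp {A B : TotModel m n →L[ℝ] TotModel m n} (hA : PreservesVertical A)
    (hB : PreservesVertical B) : (pullRes A).comp (pullRes B) = pullRes (B.comp A) := by
  refine ContinuousLinearMap.ext fun q => ?_
  obtain ⟨τ, rfl⟩ := resMk_surjective m n q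
  rw [ContinuousLinearMap.comp_apply, pullRes_mk, pullRes_mk, pullRes_mk, ← pullExt_comp hA hB]
  rfl

instance finiteDimensional_forms (m n : ℕ) :
    FiniteDimensional ℝ ((TotModel m n) [⋀^Fin m]→L[ℝ] ℝ) := by
  let f : ((TotModel m n) [⋀^Fin m]→L[ℝ] ℝ) →ₗ[ℝ]
      MultilinearMap ℝ (fun _ : Fin m => TotModel m n) ℝ :=
    { toFun := fun τ => τ.toMultilinearMap
      map_add' := fun _ _ => rfl
      map_smul' := fun _ _ => rfl }
  refine FiniteDimensional.of_injective f ?_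
  intro a b hab
  ext v
  exact congrArg (fun g : MultilinearMap ℝ (fun _ : Fin m => TotModel m n) ℝ => g v) hab

instance finiteDimensional_extFibre (m n : ℕ) : FiniteDimensional ℝ (ExtFibre m n) :=
  FiniteDimensional.of_injective (inclForm m n).toLinearMap (inclForm m n).injective

instance finiteDimensional_resFibre (m n : ℕ) : FiniteDimensional ℝ (ResFibre m n) :=
  Module.Finite.of_surjective (resMk m n).toLinearMap (resMk_surjective m n)

theorem contDiff_of_comp_injective {X A B : Type*} [NormedAddCommGroup X] [NormedSpace ℝ X]
    [NormedAddCommGroup A] [NormedSpace ℝ A] [NormedAddCommGroup B] [NormedSpace ℝ B]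
    [FiniteDimensional ℝ B] (L : A →ₗ[ℝ] B) (hL : Function.Injective L) {f : X → A}
    (hf : ContDiff ℝ ∞ fun x => L (f x)) : ContDiff ℝ ∞ f := by
  obtain ⟨R, hR⟩ := L.exists_leftInverse_of_injective (LinearMap.ker_eq_bot.2 hL)
  have h := R.toContinuousLinearMap.contDiff.comp hf
  have h2 : (R.toContinuousLinearMap ∘ fun x => L (f x)) = f := by
    funext x
    exact LinearMap.congr_fun hR (f x)
  rwa [h2] at h

theorem contDiff_pullExt : ContDiff ℝ ∞ (pullExt (m := m) (n := n)) := by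
  rw [contDiff_clm_apply_iff]
  intro τ
  refine contDiff_of_comp_injective (inclForm m n).toLinearMap (inclForm m n).injective ?_
  have hfin : FiniteDimensional ℝ
      (ContinuousMultilinearMap ℝ (fun _ : Fin m => TotModel m n) ℝ) :=
    FiniteDimensional.of_injective
      ({ toFun := fun τ => τ.toMultilinearMap
         map_add' := fun _ _ => rfl
         map_smul' := fun _ _ => rfl } :
        ContinuousMultilinearMap ℝ (fun _ : Fin m => TotModel m n) ℝ →ₗ[ℝ]
          MultilinearMap ℝ (fun _ : Fin m => TotModel m n) ℝ)
      ContinuousMultilinearMap.toMultilinearMap_injective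
  refine contDiff_of_comp_injective
    (ContinuousAlternatingMap.toContinuousMultilinearMapLI (𝕜 := ℝ) (E := TotModel m n)
      (F := ℝ) (ι := Fin m)).toLinearMap
    (ContinuousAlternatingMap.toContinuousMultilinearMapLI (𝕜 := ℝ) (E := TotModel m n)
      (F := ℝ) (ι := Fin m)).injective ?_
  have h : ContDiff ℝ ∞ fun f : Fin m → (TotModel m n →L[ℝ] TotModel m n) =>
      (inclForm m n τ).toContinuousMultilinearMap.compContinuousLinearMap f := by
    exact (ContinuousMultilinearMap.contDiff
      (ContinuousMultilinearMap.compContinuousLinearMapContinuousMultilinear ℝ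
        (fun _ : Fin m => TotModel m n) (fun _ : Fin m => TotModel m n) ℝ)).clm_apply
      contDiff_const
  exact h.comp (contDiff_pi.2 fun _ => (lowerTri (m := m) (n := n)).contDiff)

theorem contDiff_pullRes : ContDiff ℝ ∞ (pullRes (m := m) (n := n)) := by
  rw [contDiff_clm_apply_iff]
  intro q
  obtain ⟨τ, rfl⟩ := resMk_surjective m n q
  exact (resMk m n).contDiff.comp (contDiff_pullExt.clm_apply contDiff_const)

/-! ### Bundles `π : E → M` and the dual jet bundles -/

section Bundles

variable (m n)

/-- `π : E → M` is a bundle of rank `n` over an `m`-dimensional manifold, presented by an atlas of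
charts `(xⁱ, uᵅ)` of `E` that are adapted to `π`: the component `(xⁱ)` of each of these charts is a
smooth chart of `M` composed with `π`. -/
class FibredManifold {M E : Type*} [TopologicalSpace M] [ChartedSpace (BaseModel m) M]
    [TopologicalSpace E] [ChartedSpace (TotModel m n) E] (π : E → M) : Prop where
  surjective : Function.Surjective π
  adapted : ∀ e ∈ atlas (TotModel m n) E,
    ∃ φ ∈ IsManifold.maximalAtlas 𝓘(ℝ, BaseModel m) ∞ M,
      ∀ u ∈ e.source, π u ∈ φ.source ∧ (e u).1 = φ (π u)

variable {M E : Type*} [TopologicalSpace M] [ChartedSpace (BaseModel m) M]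
  [TopologicalSpace E] [ChartedSpace (TotModel m n) E]
  [IsManifold 𝓘(ℝ, TotModel m n) ∞ E]

/-- The derivatives of the changes of adapted coordinates preserve the vertical vectors. -/
theorem preservesVertical_coordChange (π : E → M) [FibredManifold m n π]
    (i j : atlas (TotModel m n) E) {x : E} (hi : x ∈ i.1.source) (hj : x ∈ j.1.source) :
    PreservesVertical ((tangentBundleCore 𝓘(ℝ, TotModel m n) E).coordChange i j x) := by
  intro v
  obtain ⟨φ, -, hφ⟩ := FibredManifold.adapted (π := π) i.1 i.2
  obtain ⟨φ', -, hφ'⟩ := FibredManifold.adapted (π := π) j.1 j.2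
  set g : TotModel m n → TotModel m n := fun y => j.1 (i.1.symm y) with hg
  have hcd : (tangentBundleCore 𝓘(ℝ, TotModel m n) E).coordChange i j x
      = fderiv ℝ g (i.1 x) := by
    rw [tangentBundleCore_coordChange]
    simp only [modelWithCornersSelf_coe, range_id, fderivWithin_univ]
    rfl
  have hdiff : DifferentiableAt ℝ g (i.1 x) := by
    have h := ModelWithCorners.contDiffWithinAt_extendCoordChange' (n := ∞)
      (I := 𝓘(ℝ, TotModel m n))
      (IsManifold.subset_maximalAtlas i.2) (IsManifold.subset_maximalAtlas j.2) hi hj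
    have h2 := h.differentiableWithinAt (by simp)
    simp only [modelWithCornersSelf_coe, range_id, differentiableWithinAt_univ] at h2
    exact h2
  have hline : HasDerivAt (fun t : ℝ => i.1 x + t • ((0 : BaseModel m), v)) ((0 : BaseModel m), v)
      0 := by
    simpa using ((hasDerivAt_id (0 : ℝ)).smul_const ((0 : BaseModel m), v)).const_add (i.1 x)
  have hdiff' : HasFDerivAt g (fderiv ℝ g (i.1 x))
      (i.1 x + (0 : ℝ) • ((0 : BaseModel m), v)) := by
    simpa using hdiff.hasFDerivAt
  have hcomp := (ContinuousLinearMap.fst ℝ (BaseModel m) (FibreModel n)).hasFDerivAt.comp_hasDerivAt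
    (0 : ℝ) (hdiff'.comp_hasDerivAt (0 : ℝ) hline)
  have hconst : (fun t : ℝ => (g (i.1 x + t • ((0 : BaseModel m), v))).1) =ᶠ[𝓝 0]
      fun _ => φ' (φ.symm (i.1 x).1) := by
    have hopen : IsOpen (i.1.target ∩ i.1.symm ⁻¹' j.1.source) :=
      i.1.isOpen_inter_preimage_symm j.1.open_source
    have hmem : i.1 x + (0 : ℝ) • ((0 : BaseModel m), v) ∈
        i.1.target ∩ i.1.symm ⁻¹' j.1.source := by
      simp only [zero_smul, add_zero]
      exact ⟨i.1.map_source hi, by simpa [i.1.left_inv hi] using hj⟩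
    filter_upwards [hline.continuousAt.preimage_mem_nhds (hopen.mem_nhds hmem)] with t ht
    obtain ⟨ht1, ht2⟩ := ht
    have e1 := hφ _ (i.1.map_target ht1)
    have e2 := hφ' _ ht2
    rw [i.1.right_inv ht1] at e1
    have e3 : π (i.1.symm (i.1 x + t • ((0 : BaseModel m), v))) = φ.symm (i.1 x).1 := by
      rw [← φ.left_inv e1.1, ← e1.2]
      simp
    change (j.1 (i.1.symm (i.1 x + t • ((0 : BaseModel m), v)))).1 = _
    rw [e2.2, e3]
  have hzero := (hasDerivAt_const (0 : ℝ) (φ' (φ.symm (i.1 x).1))).congr_of_eventuallyEq hconst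
  rw [hcd]
  exact hcomp.unique hzero

/-- The vector bundle over `E` associated with a contravariant action `ρ` of the vertical-preserving
linear maps, in the charts of `E`. The index of the preferred trivialization at `u : E` is the chart
that Mathlib uses to identify `T_u E` with the model, so that the fibre at `u` is the same
functor of vector spaces applied to `T_u E`. -/
def assocCore {F : Type*} [NormedAddCommGroup F] [NormedSpace ℝ F] (π : E → M)
    [FibredManifold m n π] (ρ : (TotModel m n →L[ℝ] TotModel m n) → F →L[ℝ] F)
    (hρ : ContDiff ℝ ∞ ρ) (hid : ρ (ContinuousLinearMap.id ℝ _) = ContinuousLinearMap.id ℝ _)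
    (hcomp : ∀ A B, PreservesVertical A → PreservesVertical B →
      (ρ A).comp (ρ B) = ρ (B.comp A)) :
    VectorBundleCore ℝ E F (atlas (TotModel m n) E) where
  baseSet i := i.1.source
  isOpen_baseSet i := i.1.open_source
  indexAt := achart (TotModel m n)
  mem_baseSet_at := mem_chart_source (TotModel m n)
  coordChange i j x := ρ ((tangentBundleCore 𝓘(ℝ, TotModel m n) E).coordChange j i x)
  coordChange_self i x hx v := by
    have h : (tangentBundleCore 𝓘(ℝ, TotModel m n) E).coordChange i i x =
        ContinuousLinearMap.id ℝ _ :=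
      ContinuousLinearMap.ext fun w =>
        (tangentBundleCore 𝓘(ℝ, TotModel m n) E).coordChange_self i x hx w
    rw [h, hid]
    rfl
  continuousOn_coordChange i j := by
    refine hρ.continuous.comp_continuousOn ?_
    exact ((tangentBundleCore 𝓘(ℝ, TotModel m n) E).continuousOn_coordChange j i).mono
      (by rw [inter_comm]; exact subset_rfl)
  coordChange_comp i j k x hx v := by
    obtain ⟨⟨hi, hj⟩, hk⟩ := hx
    rw [← ContinuousLinearMap.comp_apply, hcomp _ _
      (preservesVertical_coordChange m n π k j hk hj)
      (preservesVertical_coordChange m n π j i hj hi),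
      (tangentBundleCore 𝓘(ℝ, TotModel m n) E).coordChange_linear_comp k j i x ⟨⟨hk, hj⟩, hi⟩]

/-- `Λᵐ₂(T*E)` as a vector bundle over `E`. -/
def extCore (π : E → M) [FibredManifold m n π] :
    VectorBundleCore ℝ E (ExtFibre m n) (atlas (TotModel m n) E) :=
  assocCore m n π pullExt contDiff_pullExt pullExt_id fun _ _ => pullExt_comp

/-- `Λᵐ₂(T*E) / Λᵐ₁(T*E)` as a vector bundle over `E`. -/
def resCore (π : E → M) [FibredManifold m n π] :
    VectorBundleCore ℝ E (ResFibre m n) (atlas (TotModel m n) E) :=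
  assocCore m n π pullRes contDiff_pullRes pullRes_id fun _ _ => pullRes_comp

theorem contMDiffOn_tangent_coordChange (i j : atlas (TotModel m n) E) :
    ContMDiffOn 𝓘(ℝ, TotModel m n) 𝓘(ℝ, TotModel m n →L[ℝ] TotModel m n) ∞
      ((tangentBundleCore 𝓘(ℝ, TotModel m n) E).coordChange j i) (i.1.source ∩ j.1.source) := by
  have : IsManifold 𝓘(ℝ, TotModel m n) (∞ + 1) E := by simpa
  have : (tangentBundleCore 𝓘(ℝ, TotModel m n) E).IsContMDiff 𝓘(ℝ, TotModel m n) ∞ :=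
    tangentBundleCore.isContMDiff
  rw [inter_comm]
  exact (tangentBundleCore 𝓘(ℝ, TotModel m n) E).contMDiffOn_coordChange
    𝓘(ℝ, TotModel m n) j i

instance isContMDiff_extCore (π : E → M) [FibredManifold m n π] :
    (extCore m n π).IsContMDiff 𝓘(ℝ, TotModel m n) ∞ :=
  ⟨fun i j => contDiff_pullExt.contMDiff.comp_contMDiffOn
    (contMDiffOn_tangent_coordChange m n i j)⟩

instance isContMDiff_resCore (π : E → M) [FibredManifold m n π] :
    (resCore m n π).IsContMDiff 𝓘(ℝ, TotModel m n) ∞ :=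
  ⟨fun i j => contDiff_pullRes.contMDiff.comp_contMDiffOn
    (contMDiffOn_tangent_coordChange m n i j)⟩

/-- The extended dual jet bundle `Λᵐ₂(T*E)`, a smooth manifold. The projection `π_E` to `E` is
`Bundle.TotalSpace.proj`. -/
abbrev ExtDual (π : E → M) [FibredManifold m n π] : Type _ :=
  Bundle.TotalSpace (ExtFibre m n) (extCore m n π).Fiber

/-- The restricted dual jet bundle `J¹π* = Λᵐ₂(T*E) / Λᵐ₁(T*E)`, a smooth manifold. The projection
`π_E^r` to `E` is `Bundle.TotalSpace.proj`. -/
abbrev ResDual (π : E → M) [FibredManifold m n π] : Type _ :=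
  Bundle.TotalSpace (ResFibre m n) (resCore m n π).Fiber

/-- Model with corners (without boundary) of `ExtDual`. -/
abbrev extModel : ModelWithCorners ℝ (TotModel m n × ExtFibre m n)
    (ModelProd (TotModel m n) (ExtFibre m n)) :=
  𝓘(ℝ, TotModel m n).prod 𝓘(ℝ, ExtFibre m n)

/-- Model with corners (without boundary) of `ResDual`. -/
abbrev resModel : ModelWithCorners ℝ (TotModel m n × ResFibre m n)
    (ModelProd (TotModel m n) (ResFibre m n)) :=
  𝓘(ℝ, TotModel m n).prod 𝓘(ℝ, ResFibre m n)

/-- The quotient map `μ : Λᵐ₂(T*E) → J¹π*`. -/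
def quotientMap (π : E → M) [FibredManifold m n π] (q : ExtDual m n π) : ResDual m n π :=
  ⟨q.proj, resMk m n (show ExtFibre m n from q.2)⟩

/-- A point of `Λᵐ₂(T*E)` over `u` as an alternating form on `T_u E`. -/
def toForm (π : E → M) [FibredManifold m n π] (q : ExtDual m n π) :
    TangentSpace 𝓘(ℝ, TotModel m n) q.proj [⋀^Fin m]→L[ℝ] ℝ :=
  inclForm m n (show ExtFibre m n from q.2)

end Bundles

/-! ### Differential forms, distributions and integral sections on manifolds -/

section Manifolds

variable {V : Type*} [NormedAddCommGroup V] [NormedSpace ℝ V] {H : Type*} [TopologicalSpace H]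
  (I : ModelWithCorners ℝ V H) {P : Type*} [TopologicalSpace P] [ChartedSpace H P]
  {V' : Type*} [NormedAddCommGroup V'] [NormedSpace ℝ V'] {H' : Type*} [TopologicalSpace H']
  (I' : ModelWithCorners ℝ V' H') {P' : Type*} [TopologicalSpace P'] [ChartedSpace H' P']

variable (P) in
/-- Differential `k`-forms (no regularity is imposed here). -/
abbrev DiffForm (k : ℕ) : Type _ := ∀ p : P, TangentSpace I p [⋀^Fin k]→L[ℝ] ℝ

/-- Pull-back `f*τ`. -/
def pullback {k : ℕ} (f : P → P') (τ : DiffForm I' P' k) : DiffForm I P k :=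
  fun p => (τ (f p)).compContinuousLinearMap (mfderiv I I' f p)

/-- Exterior derivative of a form on a manifold, computed at each point in the preferred chart
there. -/
def extDiff {k : ℕ} (τ : DiffForm I P k) : DiffForm I P (k + 1) := fun p =>
  (extDerivWithin
    (fun y : V => ((τ ((extChartAt I p).symm y)).compContinuousLinearMap
      (mfderivWithin 𝓘(ℝ, V) I (extChartAt I p).symm (range I) y) : V [⋀^Fin k]→L[ℝ] ℝ))
    (range I) (extChartAt I p p)).compContinuousLinearMap
      (mfderiv I 𝓘(ℝ, V) (extChartAt I p) p)

/-- `T_p f`-image of the whole tangent space: the tangent space to `Im f` at `f p` for an immersion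
`f`. -/
def tangentImage (f : P → P') (p : P) : Submodule ℝ (TangentSpace I' (f p)) :=
  LinearMap.range (mfderiv I I' f p : TangentSpace I p →ₗ[ℝ] TangentSpace I' (f p))

/-- The `l`-th orthogonal complement of a subspace with respect to an alternating
`(l+1)`-form. -/
def orthogonalComplement {l : ℕ} {p : P} (τ : TangentSpace I p [⋀^Fin (l + 1)]→L[ℝ] ℝ)
    (F : Submodule ℝ (TangentSpace I p)) : Set (TangentSpace I p) :=
  {w | ∀ v : Fin l → TangentSpace I p, (∀ i, v i ∈ F) →
    τ (Fin.cons (α := fun _ => TangentSpace I p) w v) = 0}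

/-- The submanifold parametrized by `f` is `l`-Lagrangian for the `(l+1)`-form `τ`. -/
def IsLagrangianImage {l : ℕ} (τ : DiffForm I' P' (l + 1)) (f : P → P') : Prop :=
  ∀ p : P, (tangentImage I I' f p : Set (TangentSpace I' (f p))) =
    orthogonalComplement I' (τ (f p)) (tangentImage I I' f p)

variable (P) in
/-- A (not necessarily regular) field of subspaces of the tangent spaces. -/
abbrev Distribution : Type _ := ∀ p : P, Submodule ℝ (TangentSpace I p)

variable {I} in
/-- `D` is a smooth distribution of rank `k`: locally it is spanned by `k` pointwise linearly
independent smooth vector fields. -/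
def IsSmoothOfRank [IsManifold I 1 P] (k : ℕ) (D : Distribution I P) : Prop :=
  ∀ p : P, ∃ U : Set P, IsOpen U ∧ p ∈ U ∧
    ∃ X : Fin k → ∀ q : P, TangentSpace I q,
      (∀ i, ContMDiffOn I I.tangent ∞ (fun q => (⟨q, X i q⟩ : TangentBundle I P)) U) ∧
      ∀ q ∈ U, LinearIndependent ℝ (fun i => X i q) ∧
        D q = Submodule.span ℝ (Set.range fun i => X i q)

variable {I} in
/-- `D` is transverse to the fibres of `f`. -/
def IsTransverse (f : P → P') (D : Distribution I P) : Prop :=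
  ∀ p : P, IsCompl (D p)
    (LinearMap.ker (mfderiv I I' f p : TangentSpace I p →ₗ[ℝ] TangentSpace I' (f p)))

variable {I} in
/-- `σ` is an integral section over `N` of the distribution `D` on the total space of `f : P → P'`:
on an open neighbourhood of `N` it is a smooth section of `f` whose image has tangent space `D`.
(If `N` is open, that neighbourhood may be taken to be `N` itself; the values of `σ` outside of the
neighbourhood play no role.) -/
def IsIntegralSection (f : P → P') (D : Distribution I P) (N : Set P') (σ : P' → P) : Prop :=
  ∃ U : Set P', IsOpen U ∧ N ⊆ U ∧ ContMDiffOn I' I ∞ σ U ∧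
    ∀ x ∈ U, f (σ x) = x ∧ tangentImage I' I σ x = D (σ x)

variable {I} in
/-- Integrability of a distribution that is transverse to `f`: through every point there passes
an integral section. -/
def IsIntegrable (f : P → P') (D : Distribution I P) : Prop :=
  ∀ p : P, ∃ σ : P' → P, IsIntegralSection I' f D {f p} σ ∧ σ (f p) = p

/-- `N` is a connected domain with smooth nonempty boundary: near each of its points `N` is either
everything or a half space `{g ≤ 0}` with `g` smooth, and the points of the second kind, which
form the boundary `N \ interior N`, do occur. -/
structure IsDomainWithBoundary (N : Set P) : Prop where
  connected : IsConnected N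
  boundary_nonempty : (N \ interior N).Nonempty
  smooth_boundary : ∀ x ∈ N \ interior N, ∃ (U : Set P) (g : P → ℝ), IsOpen U ∧ x ∈ U ∧
    ContMDiffOn I 𝓘(ℝ, ℝ) ∞ g U ∧ g x = 0 ∧ mfderiv I 𝓘(ℝ, ℝ) g x ≠ 0 ∧
    N ∩ U = {y ∈ U | g y ≤ 0}

end Manifolds

/-! ### Hamiltonian field theory and the Hamilton–Jacobi problem -/

section Hamiltonian

variable (m n)
variable {M E : Type*} [TopologicalSpace M] [ChartedSpace (BaseModel m) M]
  [TopologicalSpace E] [ChartedSpace (TotModel m n) E]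
  [IsManifold 𝓘(ℝ, TotModel m n) ∞ E] (π : E → M) [FibredManifold m n π]

/-- The Liouville (tautological) `m`-form on `Λᵐ₂(T*E)`. -/
def liouvilleForm : DiffForm (extModel m n) (ExtDual m n π) m := fun q =>
  (toForm m n π q).compContinuousLinearMap
    (mfderiv (extModel m n) 𝓘(ℝ, TotModel m n) Bundle.TotalSpace.proj q)

/-- `h` is a Hamiltonian section, that is, a smooth section of `μ : Λᵐ₂(T*E) → J¹π*`. -/
def IsHamiltonianSection (h : ResDual m n π → ExtDual m n π) : Prop :=
  ContMDiff (resModel m n) (extModel m n) ∞ h ∧ ∀ p, quotientMap m n π (h p) = p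

/-- The Hamilton–Cartan form `Ω_h = -d(h*Θ)`. -/
def hamiltonCartan (h : ResDual m n π → ExtDual m n π) :
    DiffForm (resModel m n) (ResDual m n π) (m + 1) := fun p =>
  -extDiff (resModel m n) (pullback (resModel m n) (extModel m n) h (liouvilleForm m n π)) p

/-- The projection of `J¹π*` to `M`. -/
def projBase (p : ResDual m n π) : M := π p.proj

/-- The field equation: `ψ* (i(X) Ω) = 0` on `U` for every smooth vector field `X`. -/
def SolvesFieldEquation (Ω : DiffForm (resModel m n) (ResDual m n π) (m + 1)) (U : Set M)
    (ψ : M → ResDual m n π) : Prop :=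
  ∀ X : ∀ p : ResDual m n π, TangentSpace (resModel m n) p,
    ContMDiff (resModel m n) (resModel m n).tangent ∞
      (fun p => (⟨p, X p⟩ : TangentBundle (resModel m n) (ResDual m n π))) →
    ∀ x ∈ U, ∀ v : Fin m → TangentSpace 𝓘(ℝ, BaseModel m) x,
      Ω (ψ x) (Fin.cons (α := fun _ => TangentSpace (resModel m n) (ψ x)) (X (ψ x))
        fun i => mfderiv 𝓘(ℝ, BaseModel m) (resModel m n) ψ x (v i)) = 0

/-- `D` is a solution of the Hamiltonian problem: a smooth distribution in `J¹π*` of rank `m`,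
transverse to the projection to `M`, integrable, all of whose integral sections solve the
field equation. -/
structure IsHamiltonianDistribution (h : ResDual m n π → ExtDual m n π)
    (D : Distribution (resModel m n) (ResDual m n π)) : Prop where
  smooth : IsSmoothOfRank m D
  transverse : IsTransverse 𝓘(ℝ, BaseModel m) (projBase m n π) D
  integrable : IsIntegrable 𝓘(ℝ, BaseModel m) (projBase m n π) D
  field_equation : ∀ (U : Set M) (ψ : M → ResDual m n π), IsOpen U →
    IsIntegralSection 𝓘(ℝ, BaseModel m) (projBase m n π) D U ψ →
    SolvesFieldEquation m n π (hamiltonCartan m n π h) U ψ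

/-- Smooth sections of `J¹π* → E`. -/
abbrev DualSection : Type _ :=
  ContMDiffSection 𝓘(ℝ, TotModel m n) (ResFibre m n) ∞ (resCore m n π).Fiber

variable {m n π}

/-- A section of `J¹π* → E` as a map into the manifold `J¹π*`. -/
abbrev DualSection.toMap (s : DualSection m n π) (u : E) : ResDual m n π := ⟨u, s u⟩

/-- The distribution `Tπ_E^r (D|_{Im s})` on `E` associated with `s`. -/
def projectedDistribution (s : DualSection m n π)
    (D : Distribution (resModel m n) (ResDual m n π)) : Distribution 𝓘(ℝ, TotModel m n) E :=
  fun u => (D (s.toMap u)).map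
    (mfderiv (resModel m n) 𝓘(ℝ, TotModel m n) Bundle.TotalSpace.proj (s.toMap u) :
      TangentSpace (resModel m n) (s.toMap u) →ₗ[ℝ] TangentSpace 𝓘(ℝ, TotModel m n) u)

/-- `s` solves the generalized Hamiltonian Hamilton–Jacobi problem: the associated distribution is
integrable and `s` maps its (local) integral sections to integral sections of `D`. -/
def SolvesGeneralizedHJ (D : Distribution (resModel m n) (ResDual m n π))
    (s : DualSection m n π) : Prop :=
  IsIntegrable 𝓘(ℝ, BaseModel m) π (projectedDistribution s D) ∧
  ∀ (U : Set M) (γ : M → E), IsOpen U →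
    IsIntegralSection 𝓘(ℝ, BaseModel m) π (projectedDistribution s D) U γ →
    IsIntegralSection 𝓘(ℝ, BaseModel m) (projBase m n π) D U fun x => s.toMap (γ x)

/-- `s` solves the Hamiltonian Hamilton–Jacobi problem. -/
def SolvesHJ (h : ResDual m n π → ExtDual m n π)
    (D : Distribution (resModel m n) (ResDual m n π)) (s : DualSection m n π) : Prop :=
  SolvesGeneralizedHJ D s ∧
    pullback 𝓘(ℝ, TotModel m n) (resModel m n) s.toMap (hamiltonCartan m n π h) = 0

/-- The distribution `D` is tangent to the submanifold `Im s`. -/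
def IsTangentTo (D : Distribution (resModel m n) (ResDual m n π)) (s : DualSection m n π) : Prop :=
  ∀ u : E, D (s.toMap u) ≤ tangentImage 𝓘(ℝ, TotModel m n) (resModel m n) s.toMap u

/-- `ψ` satisfies boundary conditions in `Im s` on the domain with boundary `N`. -/
def HasBoundaryValuesIn (s : DualSection m n π) (N : Set M) (ψ : M → ResDual m n π) : Prop :=
  ∀ x ∈ N \ interior N, ψ x ∈ Set.range s.toMap

/-- The integral sections of `D` with boundary conditions in `Im s` project onto the integral
sections of the integrable distribution associated with `s`: over each domain with boundary, the
projections of the former are integral sections of the latter, and all of them arise so. -/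
def BoundarySectionsProjectOnto (D : Distribution (resModel m n) (ResDual m n π))
    (s : DualSection m n π) : Prop :=
  IsIntegrable 𝓘(ℝ, BaseModel m) π (projectedDistribution s D) ∧
  ∀ N : Set M, IsDomainWithBoundary 𝓘(ℝ, BaseModel m) N →
    (∀ ψ : M → ResDual m n π,
      IsIntegralSection 𝓘(ℝ, BaseModel m) (projBase m n π) D N ψ → HasBoundaryValuesIn s N ψ →
      IsIntegralSection 𝓘(ℝ, BaseModel m) π (projectedDistribution s D) N
        fun x => (ψ x).proj) ∧
    (∀ γ : M → E,
      IsIntegralSection 𝓘(ℝ, BaseModel m) π (projectedDistribution s D) N γ →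
      ∃ ψ : M → ResDual m n π,
        IsIntegralSection 𝓘(ℝ, BaseModel m) (projBase m n π) D N ψ ∧
        HasBoundaryValuesIn s N ψ ∧ ∀ x ∈ N, (ψ x).proj = γ x)

end Hamiltonian

end

end HJ

/-!
Contracting `Ω_h` with a vector `w` tangent to the fibres of `J¹π* → E` returns, up to sign, the
derivative of `h` along `w`, and `μ ∘ h = id` makes that derivative injective in `w`. Hence no
nonzero vertical vector is orthogonal to a complement of the vertical space, so an isotropic section
is `m`-Lagrangian and only the tangency of `𝒟_h` to `Im s` is left to compare with the other
conditions.

In charts, an integral section of a transverse distribution solves a total differential equation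
`ψ' = Λ ∘ ψ` with `Λ` smooth. Grönwall's inequality shows that such sections are determined by one
value, and also that, if `𝒟_h` is tangent to `Im s`, they stay in `Im s` once they meet it: the
defect `s ∘ π_E^r ∘ ψ - ψ` satisfies a linear differential inequality. Both the integrability of
`𝒟` and condition 3 follow.

Conversely, assume condition 3. Let `γ` be the integral section of `𝒟` through `u` and `ψ` that of
`𝒟_h` through `s u`, both over a neighbourhood of `x₀ = π u`. Each `x ≠ x₀` close to `x₀` lies with
`x₀` on the boundary of a small domain `N`, and condition 3 yields an integral section `ψ'` of `𝒟_h`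
over `N` which equals `s ∘ γ` on the boundary. By uniqueness `ψ' = ψ`, so `ψ x = s (γ x)`. Thus
`s ∘ γ` is an integral section near `x₀`, and `𝒟_h` is tangent to `Im s` at `s u`.
-/

namespace HJ

section TotalDifferentialEquations

variable {F G V : Type*} [NormedAddCommGroup F] [NormedSpace ℝ F] [NormedAddCommGroup G]
  [NormedSpace ℝ G] [NormedAddCommGroup V] [NormedSpace ℝ V]

theorem eventually_eq_zero_of_norm_fderiv_le {δ : V → G} {δ' : V → V →L[ℝ] G} {K : ℝ} {z₀ : V}
    (hδ : ∀ᶠ z in 𝓝 z₀, HasFDerivAt δ (δ' z) z ∧ ‖δ' z‖ ≤ K * ‖δ z‖) (h0 : δ z₀ = 0) :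
    ∀ᶠ z in 𝓝 z₀, δ z = 0 := by
  obtain ⟨r, hr, hball⟩ := Metric.eventually_nhds_iff_ball.1 hδ
  filter_upwards [Metric.ball_mem_nhds z₀ hr] with z hz
  let c : ℝ → V := fun t => z₀ + t • (z - z₀)
  have hc : ∀ t ∈ Icc (0 : ℝ) 1, c t ∈ Metric.ball z₀ r := fun t ht => by
    simpa [c] using (convex_ball z₀ r).add_smul_sub_mem (Metric.mem_ball_self hr) hz ht
  have hderiv : ∀ t ∈ Icc (0 : ℝ) 1, HasDerivAt (δ ∘ c) (δ' (c t) (z - z₀)) t := fun t ht => by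
    refine (hball _ (hc t ht)).1.comp_hasDerivAt t ?_
    simpa [c] using ((hasDerivAt_id t).smul_const (z - z₀)).const_add z₀
  have hbound : ∀ t ∈ Ico (0 : ℝ) 1, ‖δ' (c t) (z - z₀)‖ ≤ K * ‖z - z₀‖ * ‖(δ ∘ c) t‖ :=
    fun t ht => calc
      ‖δ' (c t) (z - z₀)‖ ≤ ‖δ' (c t)‖ * ‖z - z₀‖ := (δ' (c t)).le_opNorm _
      _ ≤ K * ‖δ (c t)‖ * ‖z - z₀‖ := by
        gcongr
        exact (hball _ (hc t (Ico_subset_Icc_self ht))).2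
      _ = K * ‖z - z₀‖ * ‖(δ ∘ c) t‖ := by rw [Function.comp_apply]; ring
  have := eq_zero_of_abs_deriv_le_mul_abs_self_of_eq_zero_right
    (fun t ht => (hderiv t ht).continuousAt.continuousWithinAt)
    (fun t ht => (hderiv t (Ico_subset_Icc_self ht)).hasDerivWithinAt) (by simpa [c] using h0)
    hbound 1 (by simp)
  simpa [c] using this

theorem eventuallyEq_of_hasFDerivAt {Λ : F → V →L[ℝ] F} {y₁ y₂ : V → F} {z₀ : V}
    (hΛ : ContDiffAt ℝ 1 Λ (y₁ z₀)) (h₁ : ∀ᶠ z in 𝓝 z₀, HasFDerivAt y₁ (Λ (y₁ z)) z)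
    (h₂ : ∀ᶠ z in 𝓝 z₀, HasFDerivAt y₂ (Λ (y₂ z)) z) (h : y₁ z₀ = y₂ z₀) :
    y₁ =ᶠ[𝓝 z₀] y₂ := by
  obtain ⟨K, t, ht, hK⟩ := hΛ.exists_lipschitzOnWith
  have ht₁ : ∀ᶠ z in 𝓝 z₀, y₁ z ∈ t := h₁.self_of_nhds.continuousAt ht
  have ht₂ : ∀ᶠ z in 𝓝 z₀, y₂ z ∈ t := h₂.self_of_nhds.continuousAt (h ▸ ht)
  have hzero : ∀ᶠ z in 𝓝 z₀, y₁ z - y₂ z = 0 := by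
    refine eventually_eq_zero_of_norm_fderiv_le (K := K)
      (δ' := fun z => Λ (y₁ z) - Λ (y₂ z)) ?_ (sub_eq_zero.2 h)
    filter_upwards [h₁, h₂, ht₁, ht₂] with z hz₁ hz₂ hzt₁ hzt₂
    exact ⟨hz₁.sub hz₂, by simpa only [dist_eq_norm] using hK.dist_le_mul _ hzt₁ _ hzt₂⟩
  exact hzero.mono fun z => sub_eq_zero.1

/- The derivative `Λ - DS ∘ Λ` of `y - S ∘ y`, as a function of `y`, vanishes on the image of `S`
and is Lipschitz, so it is bounded by a multiple of `y - S ∘ y`. -/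
theorem eventually_isFixedPt_of_hasFDerivAt {Λ : F → V →L[ℝ] F} {S : F → F} {y : V → F} {z₀ : V}
    (hΛ : ContDiffAt ℝ 1 Λ (y z₀)) (hS : ContDiffAt ℝ 2 S (y z₀)) (h : S (y z₀) = y z₀)
    (hΛS : ∀ᶠ x in 𝓝 (y z₀), (fderiv ℝ S (S x)).comp (Λ (S x)) = Λ (S x))
    (hy : ∀ᶠ z in 𝓝 z₀, HasFDerivAt y (Λ (y z)) z) :
    ∀ᶠ z in 𝓝 z₀, S (y z) = y z := by
  have hyc : ContinuousAt y z₀ := hy.self_of_nhds.continuousAt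
  have hSyc : Filter.Tendsto (S ∘ y) (𝓝 z₀) (𝓝 (y z₀)) := by
    simpa only [h] using hS.continuousAt.tendsto.comp hyc
  have hG : ContDiffAt ℝ 1 (fun x => Λ x - (fderiv ℝ S x).comp (Λ x)) (y z₀) :=
    hΛ.sub ((hS.fderiv_right (by norm_num)).clm_comp hΛ)
  obtain ⟨K, t, ht, hK⟩ := hG.exists_lipschitzOnWith
  have hSd : ∀ᶠ x in 𝓝 (y z₀), DifferentiableAt ℝ S x :=
    (hS.eventually (by simp)).mono fun x hx => hx.differentiableAt (by simp)
  have hzero : ∀ᶠ z in 𝓝 z₀, y z - S (y z) = 0 := by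
    refine eventually_eq_zero_of_norm_fderiv_le (K := K)
      (δ' := fun z => Λ (y z) - (fderiv ℝ S (y z)).comp (Λ (y z))) ?_ (sub_eq_zero.2 h.symm)
    filter_upwards [hy, hyc.eventually hSd, hyc.eventually hΛS, hyc.eventually_mem ht,
      hSyc.eventually_mem ht] with z hz hzS hzΛ hzt hzSt
    refine ⟨hz.sub (hzS.hasFDerivAt.comp z hz), ?_⟩
    simpa only [dist_eq_norm, Function.comp_apply, hzΛ, sub_self, sub_zero]
      using hK.dist_le_mul _ hzt _ hzSt
  exact hzero.mono fun z hz => (sub_eq_zero.1 hz).symm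

end TotalDifferentialEquations

section IntegralSections

variable {V : Type*} [NormedAddCommGroup V] [NormedSpace ℝ V] {H : Type*} [TopologicalSpace H]
  {I : ModelWithCorners ℝ V H} {P : Type*} [TopologicalSpace P] [ChartedSpace H P]
  {V' : Type*} [NormedAddCommGroup V'] [NormedSpace ℝ V'] {H' : Type*} [TopologicalSpace H']
  {I' : ModelWithCorners ℝ V' H'} {P' : Type*} [TopologicalSpace P'] [ChartedSpace H' P']

theorem tangentImage_comp {V'' : Type*} [NormedAddCommGroup V''] [NormedSpace ℝ V''] {H'' : Type*}
    [TopologicalSpace H''] {I'' : ModelWithCorners ℝ V'' H''} {P'' : Type*} [TopologicalSpace P'']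
    [ChartedSpace H'' P''] {g : P' → P''} {f : P → P'} {p : P}
    (hg : MDifferentiableAt I' I'' g (f p)) (hf : MDifferentiableAt I I' f p) :
    tangentImage I I'' (g ∘ f) p = (tangentImage I I' f p).map
      (mfderiv I' I'' g (f p) : TangentSpace I' (f p) →ₗ[ℝ] TangentSpace I'' (g (f p))) := by
  rw [tangentImage, tangentImage, mfderiv_comp p hg hf]
  exact LinearMap.range_comp _ _

theorem tangentImage_eq_of_eventuallyEq {D : Distribution I P} {σ τ : P' → P} {x : P'}
    (hστ : τ =ᶠ[𝓝 x] σ) (h : tangentImage I' I σ x = D (σ x)) :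
    tangentImage I' I τ x = D (τ x) := by
  have hmfderiv : (mfderiv I' I τ x : V' →L[ℝ] V) = mfderiv I' I σ x := hστ.mfderiv_eq
  have htangent : (tangentImage I' I τ x : Submodule ℝ V) = tangentImage I' I σ x :=
    congrArg (fun A : V' →L[ℝ] V => LinearMap.range (A : V' →ₗ[ℝ] V)) hmfderiv
  have hD : (D (σ x) : Submodule ℝ V) = D (τ x) := by rw [hστ.eq_of_nhds]
  exact htangent.trans (h.trans hD)

variable {f : P → P'} {D : Distribution I P} {N N' : Set P'} {σ τ : P' → P} {x : P'}

theorem isIntegralSection_iff_eventually :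
    IsIntegralSection I' f D N σ ↔ ∀ x ∈ N, ∀ᶠ y in 𝓝 x,
      ContMDiffAt I' I ∞ σ y ∧ f (σ y) = y ∧ tangentImage I' I σ y = D (σ y) := by
  constructor
  · rintro ⟨U, hU, hNU, hσ, h⟩ x hx
    filter_upwards [hU.mem_nhds (hNU hx)] with y hy
    exact ⟨hσ.contMDiffAt (hU.mem_nhds hy), h y hy⟩
  · intro h
    exact ⟨_, isOpen_setOfPred_eventually_nhds, h,
      fun y hy => hy.self_of_nhds.1.contMDiffWithinAt, fun y hy => hy.self_of_nhds.2⟩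

namespace IsIntegralSection

theorem eventually (h : IsIntegralSection I' f D N σ) (hx : x ∈ N) : ∀ᶠ y in 𝓝 x,
    ContMDiffAt I' I ∞ σ y ∧ f (σ y) = y ∧ tangentImage I' I σ y = D (σ y) :=
  isIntegralSection_iff_eventually.1 h x hx

theorem contMDiffAt (h : IsIntegralSection I' f D N σ) (hx : x ∈ N) : ContMDiffAt I' I ∞ σ x :=
  (h.eventually hx).self_of_nhds.1

theorem apply_apply_eq (h : IsIntegralSection I' f D N σ) (hx : x ∈ N) : f (σ x) = x :=
  (h.eventually hx).self_of_nhds.2.1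

theorem tangentImage_eq (h : IsIntegralSection I' f D N σ) (hx : x ∈ N) :
    tangentImage I' I σ x = D (σ x) :=
  (h.eventually hx).self_of_nhds.2.2

theorem mono (h : IsIntegralSection I' f D N σ) (hN : N' ⊆ N) : IsIntegralSection I' f D N' σ :=
  isIntegralSection_iff_eventually.2 fun _ hx => h.eventually (hN hx)

theorem singleton (h : IsIntegralSection I' f D N σ) (hx : x ∈ N) :
    IsIntegralSection I' f D {x} σ :=
  h.mono (singleton_subset_iff.2 hx)

theorem congr (h : IsIntegralSection I' f D N σ) (hστ : ∀ x ∈ N, τ =ᶠ[𝓝 x] σ) :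
    IsIntegralSection I' f D N τ := by
  refine isIntegralSection_iff_eventually.2 fun x hx => ?_
  filter_upwards [h.eventually hx, (hστ x hx).eventuallyEq_nhds] with y ⟨hσ, hf, hD⟩ hy
  exact ⟨hσ.congr_of_eventuallyEq hy, by rw [hy.eq_of_nhds, hf],
    tangentImage_eq_of_eventuallyEq hy hD⟩

theorem exists_isOpen (h : IsIntegralSection I' f D N σ) :
    ∃ U, IsOpen U ∧ N ⊆ U ∧ IsIntegralSection I' f D U σ := by
  obtain ⟨U, hU, hNU, hσ⟩ := h
  exact ⟨U, hU, hNU, U, hU, subset_rfl, hσ⟩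

end IsIntegralSection

end IntegralSections

section HorizontalLift

variable {V : Type*} [NormedAddCommGroup V] [NormedSpace ℝ V] {H : Type*} [TopologicalSpace H]
  {I : ModelWithCorners ℝ V H} {P : Type*} [TopologicalSpace P] [ChartedSpace H P]
  {V' : Type*} [NormedAddCommGroup V'] [NormedSpace ℝ V'] {H' : Type*} [TopologicalSpace H']
  {I' : ModelWithCorners ℝ V' H'} {P' : Type*} [TopologicalSpace P'] [ChartedSpace H' P']

theorem contMDiffAt_mfderiv_extChartAt_apply [IsManifold I' 1 P'] {g : P → TangentBundle I' P'}
    {p : P} {k : ℕ∞ω} (hg : ContMDiffAt I I'.tangent k g p) :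
    ContMDiffAt I 𝓘(ℝ, V') k (fun q =>
      (mfderiv I' 𝓘(ℝ, V') (extChartAt I' (g p).proj) (g q).proj (g q).2 : V')) p := by
  obtain ⟨hproj, hsnd⟩ := Bundle.contMDiffAt_totalSpace.1 hg
  refine hsnd.congr_of_eventuallyEq ?_
  filter_upwards [hproj.continuousAt.preimage_mem_nhds
    ((chartAt H' (g p).proj).open_source.mem_nhds (mem_chart_source H' _))] with q hq
  have hmem : (g q).proj ∈ (trivializationAt V' (TangentSpace I') (g p).proj).baseSet := by
    simpa using hq
  rw [← TangentBundle.continuousLinearMapAt_trivializationAt hq]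
  exact congrFun (Bundle.Trivialization.coe_linearMapAt_of_mem (R := ℝ)
    (trivializationAt V' (TangentSpace I') (g p).proj) hmem) (g q).2

/-- The linear map `a ↦ ∑ i, a i • x i` defined by a finite family `x` of vectors, as a continuous
linear function of `x`. -/
noncomputable def frameMap (ι W : Type*) [Fintype ι] [NormedAddCommGroup W] [NormedSpace ℝ W] :
    (ι → W) ≃L[ℝ] ((ι → ℝ) →L[ℝ] W) :=
  open scoped Classical in (ContinuousLinearEquiv.piRing ι).symm

theorem frameMap_apply {ι W : Type*} [Fintype ι] [NormedAddCommGroup W] [NormedSpace ℝ W]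
    (x : ι → W) (a : ι → ℝ) : frameMap ι W x a = ∑ i, a i • x i :=
  open scoped Classical in LinearEquiv.piRing_symm_apply ℝ x a

theorem contMDiffAt_frameMap {ι W : Type*} [Fintype ι] [NormedAddCommGroup W] [NormedSpace ℝ W]
    {x : ι → P → W} {p : P} {r : ℕ∞ω} (hx : ∀ i, ContMDiffAt I 𝓘(ℝ, W) r (x i) p) :
    ContMDiffAt I 𝓘(ℝ, (ι → ℝ) →L[ℝ] W) r (fun q => frameMap ι W fun i => x i q) p :=
  (frameMap ι W).contDiff.contMDiff.contMDiffAt.comp p (contMDiffAt_pi_space.2 hx)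

theorem exists_contMDiffAt_map_frame {ι : Type*} [Finite ι] {x : ι → P → V} {y : ι → P → V'}
    {p : P} {r : ℕ∞ω} (hx : ∀ i, ContMDiffAt I 𝓘(ℝ, V) r (x i) p)
    (hy : ∀ i, ContMDiffAt I 𝓘(ℝ, V') r (y i) p)
    (hbasis : ∀ᶠ q in 𝓝 p, ∃ b : Module.Basis ι ℝ V', ∀ i, b i = y i q) :
    ∃ L : P → V' →L[ℝ] V, ContMDiffAt I 𝓘(ℝ, V' →L[ℝ] V) r L p ∧
      ∀ᶠ q in 𝓝 p, ∀ i, L q (y i q) = x i q := by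
  have := Fintype.ofFinite ι
  have hequiv : ∀ᶠ q in 𝓝 p, ∃ e : (ι → ℝ) ≃L[ℝ] V',
      (e : (ι → ℝ) →L[ℝ] V') = frameMap ι V' fun i => y i q := by
    filter_upwards [hbasis] with q ⟨b, hb⟩
    have : FiniteDimensional ℝ V' := b.finiteDimensional_of_finite
    refine ⟨b.equivFunL.symm, ContinuousLinearMap.ext fun a => ?_⟩
    simp_rw [frameMap_apply, ← hb]
    exact b.equivFun_symm_apply a
  obtain ⟨e, he⟩ := hequiv.self_of_nhds
  refine ⟨fun q => (frameMap ι V fun i => x i q).comp (frameMap ι V' fun i => y i q).inverse,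
    (contMDiffAt_frameMap hx).clm_comp ?_, ?_⟩
  · refine ContMDiffAt.comp (g := ContinuousLinearMap.inverse) p ?_ (contMDiffAt_frameMap hy)
    exact he ▸ (contDiffAt_map_inverse e).contMDiffAt
  · filter_upwards [hequiv] with q ⟨e, he⟩ i
    classical
    have hei : y i q = e (Pi.single i 1) := by
      rw [← ContinuousLinearEquiv.coe_coe, he, frameMap_apply]
      simp [Pi.single_apply]
    rw [← he, ContinuousLinearMap.inverse_equiv, hei, ContinuousLinearMap.comp_apply,
      ContinuousLinearEquiv.coe_coe, e.symm_apply_apply, frameMap_apply]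
    simp [Pi.single_apply]

variable {f : P → P'} {D : Distribution I P}

/-- `L` is the horizontal lift of the distribution `D` near `p`, in the preferred charts at `p` and
at `f p`: in coordinates, `L q v` is the vector of `D q` which `T f` maps to `v`. -/
structure IsHorizontalLiftAt (I' : ModelWithCorners ℝ V' H') [ChartedSpace H' P'] (f : P → P')
    (D : Distribution I P) (p : P) (L : P → V' →L[ℝ] V) : Prop where
  contMDiffAt : ContMDiffAt I 𝓘(ℝ, V' →L[ℝ] V) ∞ L p
  lift_eq : ∀ᶠ q in 𝓝 p, ∀ ξ ∈ D q, L q (mfderiv I' 𝓘(ℝ, V') (extChartAt I' (f p)) (f q)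
    (mfderiv I I' f q ξ)) = mfderiv I 𝓘(ℝ, V) (extChartAt I p) q ξ
  exists_lift : ∀ᶠ q in 𝓝 p, ∀ v, ∃ ξ ∈ D q, mfderiv I 𝓘(ℝ, V) (extChartAt I p) q ξ = L q v

theorem isHorizontalLiftAt_of_map_frame {ι : Type*} [Finite ι] {p : P} {L : P → V' →L[ℝ] V}
    (hL : ContMDiffAt I 𝓘(ℝ, V' →L[ℝ] V) ∞ L p) {X : ι → ∀ q : P, TangentSpace I q}
    {y : ι → P → V'} (hy : ∀ i q, y i q =
      mfderiv I' 𝓘(ℝ, V') (extChartAt I' (f p)) (f q) (mfderiv I I' f q (X i q)))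
    (hLX : ∀ᶠ q in 𝓝 p, ∀ i, L q (y i q) = mfderiv I 𝓘(ℝ, V) (extChartAt I p) q (X i q))
    (hD : ∀ᶠ q in 𝓝 p, D q = Submodule.span ℝ (range fun i => X i q))
    (hspan : ∀ᶠ q in 𝓝 p, Submodule.span ℝ (range fun i => y i q) = ⊤) :
    IsHorizontalLiftAt I' f D p L := by
  have := Fintype.ofFinite ι
  refine ⟨hL, ?_, ?_⟩
  · filter_upwards [hLX, hD] with q hq hDq ξ hξ
    rw [hDq] at hξ
    refine LinearMap.eqOn_span (f := ((L q).comp ((mfderiv I' 𝓘(ℝ, V') (extChartAt I' (f p))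
      (f q)).comp (mfderiv I I' f q))).toLinearMap)
      (g := (mfderiv I 𝓘(ℝ, V) (extChartAt I p) q).toLinearMap) ?_ hξ
    rintro - ⟨i, rfl⟩
    exact (congrArg (L q) (hy i q)).symm.trans (hq i)
  · filter_upwards [hLX, hD, hspan] with q hq hDq hyq v
    obtain ⟨a, rfl⟩ := (Submodule.mem_span_range_iff_exists_fun ℝ).1
      (hyq.ge (Submodule.mem_top (x := v)))
    rw [hDq]
    refine ⟨∑ i, a i • X i q, (Submodule.mem_span_range_iff_exists_fun ℝ).2 ⟨a, rfl⟩, ?_⟩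
    simp only [map_sum, map_smul]
    exact Finset.sum_congr rfl fun i _ => congrArg (a i • ·) (hq i).symm

theorem exists_isHorizontalLiftAt [IsManifold I ∞ P] [IsManifold I' ∞ P'] [FiniteDimensional ℝ V']
    (hf : ContMDiff I I' ∞ f) (hD : IsSmoothOfRank (Module.finrank ℝ V') D)
    (hT : IsTransverse I' f D) (p : P) : ∃ L, IsHorizontalLiftAt I' f D p L := by
  obtain ⟨U, hU, hpU, X, hX, hXD⟩ := hD p
  let y (i : Fin (Module.finrank ℝ V')) (q : P) : V' :=
    mfderiv I' 𝓘(ℝ, V') (extChartAt I' (f p)) (f q) (mfderiv I I' f q (X i q))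
  have hXp (i) : ContMDiffAt I I.tangent ∞ (fun q => (⟨q, X i q⟩ : TangentBundle I P)) p :=
    (hX i).contMDiffAt (hU.mem_nhds hpU)
  have hx (i) : ContMDiffAt I 𝓘(ℝ, V) ∞
      (fun q => (mfderiv I 𝓘(ℝ, V) (extChartAt I p) q (X i q) : V)) p :=
    contMDiffAt_mfderiv_extChartAt_apply
      (g := fun q => (⟨q, X i q⟩ : TangentBundle I P)) (hXp i)
  have hy (i) : ContMDiffAt I 𝓘(ℝ, V') ∞ (y i) p :=
    contMDiffAt_mfderiv_extChartAt_apply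
      (g := fun q => (⟨f q, mfderiv I I' f q (X i q)⟩ : TangentBundle I' P'))
      ((hf.contMDiff_tangentMap (m := ∞) (by simp)).contMDiffAt.comp p (hXp i))
  have hli : ∀ᶠ q in 𝓝 p, LinearIndependent ℝ fun i => y i q := by
    filter_upwards [hU.mem_nhds hpU, hf.continuous.continuousAt.preimage_mem_nhds
      (extChartAt_source_mem_nhds (I := I') (f p))] with q hq hq'
    have hdisjoint := (hT q).disjoint
    rw [(hXD q hq).2] at hdisjoint
    exact ((hXD q hq).1.map (f := (mfderiv I I' f q).toLinearMap) hdisjoint).map'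
      (mfderiv I' 𝓘(ℝ, V') (extChartAt I' (f p)) (f q)).toLinearMap
      (LinearMap.ker_eq_bot.2 (isInvertible_mfderiv_extChartAt hq').injective)
  obtain ⟨L, hL, hLX⟩ := exists_contMDiffAt_map_frame hx hy
    (hli.mono fun q hq => ⟨basisOfLinearIndependentOfCardEqFinrank' _ hq (by simp), by simp⟩)
  refine ⟨L, isHorizontalLiftAt_of_map_frame hL (fun _ _ => rfl) hLX ?_ ?_⟩
  · filter_upwards [hU.mem_nhds hpU] with q hq using (hXD q hq).2
  · exact hli.mono fun q hq => hq.span_eq_top_of_card_eq_finrank' (by simp)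

end HorizontalLift

section Topology

theorem eqOn_of_isPreconnected_of_eventuallyEq {X Y : Type*} [TopologicalSpace X]
    [TopologicalSpace Y] [T2Space Y] {N : Set X} (hN : IsPreconnected N) {a b : X → Y}
    (ha : ∀ x ∈ N, ContinuousAt a x) (hb : ∀ x ∈ N, ContinuousAt b x)
    (hloc : ∀ x ∈ N, a x = b x → a =ᶠ[𝓝 x] b) {x : X} (hx : x ∈ N) (hab : a x = b x) :
    EqOn a b N := by
  have hN' : N ⊆ interior {y | a y = b y} := by
    refine hN.subset_left_of_subset_union (v := interior {y | a y ≠ b y}) isOpen_interior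
      isOpen_interior ?_ ?_ ⟨x, hx, mem_interior_iff_mem_nhds.2 (hloc x hx hab)⟩
    · exact (disjoint_compl_right (a := {y | a y = b y})).mono interior_subset interior_subset
    · intro y hy
      simp only [mem_union, mem_interior_iff_mem_nhds]
      by_cases h : a y = b y
      · exact Or.inl (hloc y hy h)
      · exact Or.inr (((ha y hy).ne_iff_eventually_ne (hb y hy)).1 h)
  exact fun y hy => interior_subset (s := {y | a y = b y}) (hN' hy)

theorem t2Space_totalSpace {B F : Type*} [TopologicalSpace B] [TopologicalSpace F]
    {E : B → Type*} [TopologicalSpace (Bundle.TotalSpace F E)] [∀ b, TopologicalSpace (E b)]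
    [FiberBundle F E] [T2Space B] [T2Space F] : T2Space (Bundle.TotalSpace F E) := by
  refine ⟨fun p q hpq => ?_⟩
  by_cases h : p.proj = q.proj
  · let e := trivializationAt F E p.proj
    have hp : p ∈ e.source := FiberBundle.mem_trivializationAt_proj_source
    have hq : q ∈ e.source := by
      rw [e.mem_source, ← h]
      exact FiberBundle.mem_baseSet_trivializationAt' _
    obtain ⟨u, v, hu, hv, hpu, hqv, huv⟩ := t2_separation (e.injOn.ne hp hq hpq)
    exact ⟨e.source ∩ e ⁻¹' u, e.source ∩ e ⁻¹' v,
      e.continuousOn.isOpen_inter_preimage e.open_source hu,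
      e.continuousOn.isOpen_inter_preimage e.open_source hv, ⟨hp, hpu⟩, ⟨hq, hqv⟩,
      (huv.preimage e).mono inter_subset_right inter_subset_right⟩
  · exact separated_by_continuous (FiberBundle.continuous_proj F E) h

end Topology

section Uniqueness

variable {V : Type*} [NormedAddCommGroup V] [NormedSpace ℝ V] {H : Type*} [TopologicalSpace H]
  {I : ModelWithCorners ℝ V H} {P : Type*} [TopologicalSpace P] [ChartedSpace H P]
  {V' : Type*} [NormedAddCommGroup V'] [NormedSpace ℝ V'] {H' : Type*} [TopologicalSpace H']
  {I' : ModelWithCorners ℝ V' H'} {P' : Type*} [TopologicalSpace P'] [ChartedSpace H' P']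

theorem eventually_extChartAt_iff [I.Boundaryless] {p : P} {Q : V → Prop} :
    (∀ᶠ y in 𝓝 (extChartAt I p p), Q y) ↔ ∀ᶠ q in 𝓝 p, Q (extChartAt I p q) := by
  rw [← map_extChartAt_nhds_of_boundaryless, Filter.eventually_map]

theorem writtenInExtChartAt_apply {g : P → P'} {p q : P} (hq : q ∈ (extChartAt I p).source) :
    writtenInExtChartAt I I' p g (extChartAt I p q) = extChartAt I' (g p) (g q) := by
  rw [writtenInExtChartAt, Function.comp_apply, Function.comp_apply,
    (extChartAt I p).left_inv hq]

theorem hasMFDerivAt_extChartAt_symm [IsManifold I 1 P] [I.Boundaryless] {p : P} {z : V}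
    (hz : z ∈ (extChartAt I p).target) :
    HasMFDerivAt 𝓘(ℝ, V) I (extChartAt I p).symm z
      (mfderiv 𝓘(ℝ, V) I (extChartAt I p).symm z) := by
  have := mdifferentiableWithinAt_extChartAt_symm hz
  rw [I.range_eq_univ, mdifferentiableWithinAt_univ] at this
  exact this.hasMFDerivAt

theorem contDiffAt_comp_extChartAt_symm [IsManifold I ∞ P] [I.Boundaryless] {W : Type*}
    [NormedAddCommGroup W] [NormedSpace ℝ W] {g : P → W} {p : P}
    (hg : ContMDiffAt I 𝓘(ℝ, W) ∞ g p) :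
    ContDiffAt ℝ ∞ (g ∘ (extChartAt I p).symm) (extChartAt I p p) := by
  refine contMDiffAt_iff_contDiffAt.1 (ContMDiffAt.comp _ ?_
    ((contMDiffOn_extChartAt_symm p).contMDiffAt (extChartAt_target_mem_nhds p)))
  simpa using hg

variable {f : P → P'} {D : Distribution I P}

/- Differentiate `f ∘ ψ = id`: the vector `T ψ v` of `D` is the lift of `v`. -/
theorem hasFDerivAt_comp_extChartAt_symm_of_section [IsManifold I 1 P] [IsManifold I' 1 P']
    [I'.Boundaryless] {x₀ : P'} {p : P} {ψ : P' → P} {L : V' →L[ℝ] V} {z : V'}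
    (hz : z ∈ (extChartAt I' x₀).target)
    (hp : ψ ((extChartAt I' x₀).symm z) ∈ (extChartAt I p).source)
    (hf : MDifferentiableAt I I' f (ψ ((extChartAt I' x₀).symm z)))
    (hψ : MDifferentiableAt I' I ψ ((extChartAt I' x₀).symm z))
    (hfψ : f ∘ ψ =ᶠ[𝓝 ((extChartAt I' x₀).symm z)] id)
    (hL : ∀ ξ ∈ tangentImage I' I ψ ((extChartAt I' x₀).symm z),
      L (mfderiv I' 𝓘(ℝ, V') (extChartAt I' x₀) (f (ψ ((extChartAt I' x₀).symm z)))
        (mfderiv I I' f (ψ ((extChartAt I' x₀).symm z)) ξ)) =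
      mfderiv I 𝓘(ℝ, V) (extChartAt I p) (ψ ((extChartAt I' x₀).symm z)) ξ) :
    HasFDerivAt (extChartAt I p ∘ ψ ∘ (extChartAt I' x₀).symm) L z := by
  have hχsymm := hasMFDerivAt_extChartAt_symm hz
  have hψχ := hψ.hasMFDerivAt.comp z hχsymm
  have hφψχ := (mdifferentiableAt_extChartAt ((extChartAt_source I p) ▸ hp)).hasMFDerivAt.comp z hψχ
  have hfx : f (ψ ((extChartAt I' x₀).symm z)) ∈ (chartAt H' x₀).source := by
    rw [← extChartAt_source I', show f (ψ _) = _ from hfψ.eq_of_nhds]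
    exact (extChartAt I' x₀).map_target hz
  have hχfψχ := (mdifferentiableAt_extChartAt hfx).hasMFDerivAt.comp z
    (hf.hasMFDerivAt.comp z hψχ)
  have hid : extChartAt I' x₀ ∘ f ∘ ψ ∘ (extChartAt I' x₀).symm =ᶠ[𝓝 z] id := by
    filter_upwards [hχsymm.continuousAt.eventually hfψ,
      (isOpen_extChartAt_target x₀).mem_nhds hz] with y hy hy'
    exact (congrArg (extChartAt I' x₀) hy).trans ((extChartAt I' x₀).right_inv hy')
  have hderiv := hasMFDerivAt_unique hχfψχ
    ((hasMFDerivAt_id (I := 𝓘(ℝ, V')) z).congr_of_eventuallyEq hid)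
  refine (hasMFDerivAt_iff_hasFDerivAt.1 hφψχ).congr_fderiv (ContinuousLinearMap.ext fun v => ?_)
  exact (hL _ ⟨mfderiv 𝓘(ℝ, V') I' (extChartAt I' x₀).symm z v, rfl⟩).symm.trans
    (congrArg L (DFunLike.congr_fun hderiv v))

theorem IsHorizontalLiftAt.hasFDerivAt_writtenInExtChartAt [IsManifold I 1 P] [IsManifold I' 1 P']
    [I'.Boundaryless] (hf : MDifferentiable I I' f) {x₀ : P'} {ψ : P' → P}
    {L : P → V' →L[ℝ] V} (hL : IsHorizontalLiftAt I' f D (ψ x₀) L)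
    (hψ : IsIntegralSection I' f D {x₀} ψ) :
    ∀ᶠ z in 𝓝 (extChartAt I' x₀ x₀), HasFDerivAt (writtenInExtChartAt I' I x₀ ψ)
      (L ((extChartAt I (ψ x₀)).symm (writtenInExtChartAt I' I x₀ ψ z))) z := by
  have hψc := (hψ.contMDiffAt (mem_singleton x₀)).continuousAt
  have hlift := hL.lift_eq
  rw [hψ.apply_apply_eq (mem_singleton x₀)] at hlift
  rw [eventually_extChartAt_iff]
  filter_upwards [(hψ.eventually (mem_singleton x₀)).eventually_nhds, hψc.eventually hlift,
    extChartAt_source_mem_nhds (I := I') x₀,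
    hψc.preimage_mem_nhds (extChartAt_source_mem_nhds (I := I) (ψ x₀))] with x hx hxL hxχ hxφ
  obtain ⟨z, hz, rfl⟩ : ∃ z ∈ (extChartAt I' x₀).target, (extChartAt I' x₀).symm z = x :=
    ⟨_, (extChartAt I' x₀).map_source hxχ, (extChartAt I' x₀).left_inv hxχ⟩
  rw [(extChartAt I' x₀).right_inv hz]
  obtain ⟨hψx, -, hDx⟩ := hx.self_of_nhds
  refine hasFDerivAt_comp_extChartAt_symm_of_section hz hxφ (hf _)
    (hψx.mdifferentiableAt (by simp)) (hx.mono fun y hy => hy.2.1) ?_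
  rw [hDx, writtenInExtChartAt, Function.comp_apply, Function.comp_apply,
    (extChartAt I (ψ x₀)).left_inv hxφ]
  exact hxL

theorem fderiv_conj_extChartAt_mfderiv [IsManifold I 1 P] [I.Boundaryless] {S : P → P}
    (hS : MDifferentiable I I S) (hSS : ∀ q, S (S q) = S q) {p q : P}
    (hq : S q ∈ (extChartAt I p).source) {ξ : TangentSpace I (S q)}
    (hξ : ξ ∈ tangentImage I I S q) :
    fderiv ℝ (extChartAt I p ∘ S ∘ (extChartAt I p).symm) (extChartAt I p (S q))
      (mfderiv I 𝓘(ℝ, V) (extChartAt I p) (S q) ξ) =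
    mfderiv I 𝓘(ℝ, V) (extChartAt I p) (S q) ξ := by
  obtain ⟨a, rfl⟩ := hξ
  have hφ : MDifferentiableAt I 𝓘(ℝ, V) (extChartAt I p) (S q) :=
    mdifferentiableAt_extChartAt ((extChartAt_source I p) ▸ hq)
  have hφS := hφ.hasMFDerivAt.comp q (hS q).hasMFDerivAt
  have hconj : MDifferentiableAt 𝓘(ℝ, V) 𝓘(ℝ, V)
      (extChartAt I p ∘ S ∘ (extChartAt I p).symm) (extChartAt I p (S q)) := by
    refine MDifferentiableAt.comp _ ?_ ((hS _).comp _
      (hasMFDerivAt_extChartAt_symm ((extChartAt I p).map_source hq)).mdifferentiableAt)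
    rwa [Function.comp_apply, (extChartAt I p).left_inv hq, hSS]
  have hfix : (extChartAt I p ∘ S ∘ (extChartAt I p).symm) ∘ extChartAt I p ∘ S =ᶠ[𝓝 q]
      extChartAt I p ∘ S := by
    filter_upwards [(hS q).continuousAt.preimage_mem_nhds
      ((isOpen_extChartAt_source p).mem_nhds hq)] with r hr
    simp only [Function.comp_apply, (extChartAt I p).left_inv hr, hSS]
  exact DFunLike.congr_fun (hasMFDerivAt_unique
    (hconj.differentiableAt.hasFDerivAt.hasMFDerivAt.comp q hφS)
    (hφS.congr_of_eventuallyEq hfix)) a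

variable [IsManifold I ∞ P] [IsManifold I' ∞ P'] [FiniteDimensional ℝ V'] [I.Boundaryless]
  [I'.Boundaryless]

theorem IsIntegralSection.eventuallyEq (hf : ContMDiff I I' ∞ f)
    (hD : IsSmoothOfRank (Module.finrank ℝ V') D) (hT : IsTransverse I' f D) {x₀ : P'}
    {ψ₁ ψ₂ : P' → P} (h₁ : IsIntegralSection I' f D {x₀} ψ₁)
    (h₂ : IsIntegralSection I' f D {x₀} ψ₂) (h : ψ₁ x₀ = ψ₂ x₀) : ψ₁ =ᶠ[𝓝 x₀] ψ₂ := by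
  have := IsManifold.of_le (I := I) (M := P) (show (1 : ℕ∞ω) ≤ ∞ by simp)
  have := IsManifold.of_le (I := I') (M := P') (show (1 : ℕ∞ω) ≤ ∞ by simp)
  have hf' := hf.mdifferentiable (by simp)
  obtain ⟨L, hL⟩ := exists_isHorizontalLiftAt hf hD hT (ψ₁ x₀)
  have hchart : writtenInExtChartAt I' I x₀ ψ₁ =ᶠ[𝓝 (extChartAt I' x₀ x₀)]
      writtenInExtChartAt I' I x₀ ψ₂ := by
    refine eventuallyEq_of_hasFDerivAt (Λ := L ∘ (extChartAt I (ψ₁ x₀)).symm) ?_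
      (hL.hasFDerivAt_writtenInExtChartAt hf' h₁)
      (h ▸ (h ▸ hL : IsHorizontalLiftAt I' f D (ψ₂ x₀) L).hasFDerivAt_writtenInExtChartAt hf' h₂)
      ?_
    · rw [writtenInExtChartAt_apply (mem_extChartAt_source x₀)]
      exact (contDiffAt_comp_extChartAt_symm hL.contMDiffAt).of_le (by simp)
    · simp only [writtenInExtChartAt_apply (mem_extChartAt_source x₀), h]
  filter_upwards [eventually_extChartAt_iff.1 hchart, extChartAt_source_mem_nhds (I := I') x₀,
    (h₁.contMDiffAt rfl).continuousAt.preimage_mem_nhds (extChartAt_source_mem_nhds (I := I) _),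
    (h₂.contMDiffAt rfl).continuousAt.preimage_mem_nhds (extChartAt_source_mem_nhds (I := I) _)]
    with x hx hxχ hx₁ hx₂
  rw [writtenInExtChartAt_apply hxχ, writtenInExtChartAt_apply hxχ, h] at hx
  exact (extChartAt I (ψ₂ x₀)).injOn (h ▸ hx₁) hx₂ hx

theorem IsIntegralSection.eventually_isFixedPt (hf : ContMDiff I I' ∞ f)
    (hD : IsSmoothOfRank (Module.finrank ℝ V') D) (hT : IsTransverse I' f D) {S : P → P}
    (hS : ContMDiff I I ∞ S) (hSS : ∀ q, S (S q) = S q)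
    (hDS : ∀ q, D (S q) ≤ tangentImage I I S q) {x₀ : P'} {ψ : P' → P}
    (hψ : IsIntegralSection I' f D {x₀} ψ) (h : S (ψ x₀) = ψ x₀) :
    ∀ᶠ x in 𝓝 x₀, S (ψ x) = ψ x := by
  have := IsManifold.of_le (I := I) (M := P) (show (1 : ℕ∞ω) ≤ ∞ by simp)
  have := IsManifold.of_le (I := I') (M := P') (show (1 : ℕ∞ω) ≤ ∞ by simp)
  obtain ⟨L, hL⟩ := exists_isHorizontalLiftAt hf hD hT (ψ x₀)
  let φ := extChartAt I (ψ x₀)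
  have hSc : Filter.Tendsto S (𝓝 (ψ x₀)) (𝓝 (ψ x₀)) := by
    simpa only [ContinuousAt, h] using hS.continuous.continuousAt (x := ψ x₀)
  have hsource : ∀ᶠ q in 𝓝 (ψ x₀), q ∈ φ.source := extChartAt_source_mem_nhds _
  have hconj : ContDiffAt ℝ ∞ (φ ∘ S ∘ φ.symm) (φ (ψ x₀)) :=
    contDiffAt_comp_extChartAt_symm (g := φ ∘ S)
      (ContMDiffAt.comp _ (h.symm ▸ contMDiffAt_extChartAt) hS.contMDiffAt)
  have htangent : ∀ᶠ y in 𝓝 (φ (ψ x₀)),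
      (fderiv ℝ (φ ∘ S ∘ φ.symm) ((φ ∘ S ∘ φ.symm) y)).comp
        ((L ∘ φ.symm) ((φ ∘ S ∘ φ.symm) y)) = (L ∘ φ.symm) ((φ ∘ S ∘ φ.symm) y) := by
    rw [eventually_extChartAt_iff]
    filter_upwards [hsource, hSc.eventually hsource, hSc.eventually hL.exists_lift]
      with q hq hSq hlift
    have hconjq : (φ ∘ S ∘ φ.symm) (φ q) = φ (S q) := congrArg (φ ∘ S) (φ.left_inv hq)
    rw [hconjq, Function.comp_apply, φ.left_inv hSq]
    refine ContinuousLinearMap.ext fun v => ?_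
    obtain ⟨ξ, hξ, hξv⟩ := hlift v
    rw [ContinuousLinearMap.comp_apply, ← hξv]
    exact fderiv_conj_extChartAt_mfderiv (hS.mdifferentiable (by simp)) hSS hSq (hDS q hξ)
  have hw : writtenInExtChartAt I' I x₀ ψ (extChartAt I' x₀ x₀) = φ (ψ x₀) :=
    writtenInExtChartAt_apply (mem_extChartAt_source x₀)
  have hfixed := eventually_isFixedPt_of_hasFDerivAt (Λ := L ∘ φ.symm)
    (y := writtenInExtChartAt I' I x₀ ψ) (z₀ := extChartAt I' x₀ x₀)
    (hw ▸ (contDiffAt_comp_extChartAt_symm hL.contMDiffAt).of_le (by simp))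
    (hw ▸ hconj.of_le (WithTop.coe_le_coe.2 le_top))
    (by simp only [hw, Function.comp_apply, φ.left_inv (mem_extChartAt_source _), h])
    (hw ▸ htangent) (hL.hasFDerivAt_writtenInExtChartAt (hf.mdifferentiable (by simp)) hψ)
  have hψc := (hψ.contMDiffAt (mem_singleton x₀)).continuousAt
  filter_upwards [eventually_extChartAt_iff.1 hfixed, extChartAt_source_mem_nhds (I := I') x₀,
    hψc.eventually hsource, hψc.eventually (hSc.eventually hsource)] with x hx hxχ hψx hSψx
  simp only [writtenInExtChartAt_apply hxχ, Function.comp_apply] at hx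
  rw [φ.left_inv hψx] at hx
  exact φ.injOn hSψx hψx hx

theorem IsIntegralSection.eqOn [T2Space P] (hf : ContMDiff I I' ∞ f)
    (hD : IsSmoothOfRank (Module.finrank ℝ V') D) (hT : IsTransverse I' f D) {N : Set P'}
    (hN : IsPreconnected N) {ψ₁ ψ₂ : P' → P} (h₁ : IsIntegralSection I' f D N ψ₁)
    (h₂ : IsIntegralSection I' f D N ψ₂) {x : P'} (hx : x ∈ N) (h : ψ₁ x = ψ₂ x) :
    EqOn ψ₁ ψ₂ N :=
  eqOn_of_isPreconnected_of_eventuallyEq hN (fun _ hy => (h₁.contMDiffAt hy).continuousAt)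
    (fun _ hy => (h₂.contMDiffAt hy).continuousAt)
    (fun _ hy => (h₁.singleton hy).eventuallyEq hf hD hT (h₂.singleton hy)) hx h

end Uniqueness

section Domains

variable {V : Type*} [NormedAddCommGroup V]

section NormedSpace

variable [NormedSpace ℝ V] {H : Type*} [TopologicalSpace H] {I : ModelWithCorners ℝ V H}
  {P : Type*} [TopologicalSpace P] [ChartedSpace H P] [I.Boundaryless]

theorem interior_image_extChartAt_symm {p : P} {K : Set V} (hK : K ⊆ (extChartAt I p).target) :
    interior ((extChartAt I p).symm '' K) = (extChartAt I p).symm '' interior K := by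
  refine subset_antisymm (fun y hy => ?_) (interior_maximal (image_mono interior_subset) ?_)
  · obtain ⟨z, hz, rfl⟩ := interior_subset hy
    refine mem_image_of_mem _ (interior_maximal ?_ ((continuousOn_extChartAt_symm p)
      |>.isOpen_inter_preimage (isOpen_extChartAt_target p) isOpen_interior) ⟨hK hz, hy⟩)
    rintro w ⟨hw, hwK⟩
    obtain ⟨w', hw', hww'⟩ := interior_subset hwK
    rwa [← (extChartAt I p).symm.injOn (hK hw') hw hww']
  · rw [(extChartAt I p).symm_image_eq_source_inter_preimage (interior_subset.trans hK)]
    exact (continuousOn_extChartAt p).isOpen_inter_preimage (isOpen_extChartAt_source p)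
      isOpen_interior

theorem image_extChartAt_symm_diff_interior {p : P} {K : Set V}
    (hK : K ⊆ (extChartAt I p).target) :
    (extChartAt I p).symm '' K \ interior ((extChartAt I p).symm '' K) =
      (extChartAt I p).symm '' (K \ interior K) := by
  rw [interior_image_extChartAt_symm hK]
  exact (((extChartAt I p).symm.injOn.mono hK).image_sdiff_subset interior_subset).symm

theorem IsDomainWithBoundary.image_extChartAt_symm [IsManifold I ∞ P] {p : P} {K : Set V}
    (hK : IsDomainWithBoundary 𝓘(ℝ, V) K) (hKp : K ⊆ (extChartAt I p).target) :
    IsDomainWithBoundary I ((extChartAt I p).symm '' K) := by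
  refine ⟨hK.connected.image _ ((continuousOn_extChartAt_symm p).mono hKp), ?_, ?_⟩
  · rw [image_extChartAt_symm_diff_interior hKp]
    exact hK.boundary_nonempty.image _
  rw [image_extChartAt_symm_diff_interior hKp]
  rintro - ⟨z, hz, rfl⟩
  obtain ⟨U, g, hU, hzU, hg, hgz, hgz', hKU⟩ := hK.smooth_boundary z hz
  set χ := extChartAt I p with hχ
  have hzχ := χ.map_target (hKp hz.1)
  have hχs : ContMDiffOn I 𝓘(ℝ, V) ∞ χ χ.source := by
    simpa only [hχ, extChartAt_source] using contMDiffOn_extChartAt (I := I) (x := p)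
  refine ⟨χ.source ∩ χ ⁻¹' U, g ∘ χ, (continuousOn_extChartAt p).isOpen_inter_preimage
    (isOpen_extChartAt_source p) hU, ⟨hzχ, ?_⟩, ?_, ?_, ?_, ?_⟩
  · rwa [mem_preimage, χ.right_inv (hKp hz.1)]
  · exact hg.comp (hχs.mono inter_subset_left) inter_subset_right
  · rw [Function.comp_apply, χ.right_inv (hKp hz.1), hgz]
  · have hzχ' : (χ (χ.symm z)) = z := χ.right_inv (hKp hz.1)
    rw [mfderiv_comp _ (hzχ'.symm ▸ (hg.contMDiffAt (hU.mem_nhds hzU)).mdifferentiableAt (by simp))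
      ((hχs.contMDiffAt ((isOpen_extChartAt_source p).mem_nhds hzχ)).mdifferentiableAt (by simp))]
    intro h
    rw [hzχ'] at h
    refine hgz' (ContinuousLinearMap.ext fun v => ?_)
    obtain ⟨w, rfl⟩ := (isInvertible_mfderiv_extChartAt hzχ).surjective v
    exact DFunLike.congr_fun h w
  · ext y
    constructor
    · rintro ⟨⟨w, hw, rfl⟩, hy, hyU⟩
      refine ⟨⟨hy, hyU⟩, (hKU.subset ⟨?_, hyU⟩).2⟩
      rwa [χ.right_inv (hKp hw)]
    · rintro ⟨⟨hy, hyU⟩, hgy⟩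
      exact ⟨⟨χ y, (hKU.superset ⟨hyU, hgy⟩).1, χ.left_inv hy⟩, hy, hyU⟩

end NormedSpace

variable [InnerProductSpace ℝ V]

theorem isDomainWithBoundary_closedBall [Nontrivial V] (c : V) {r : ℝ} (hr : 0 < r) :
    IsDomainWithBoundary 𝓘(ℝ, V) (Metric.closedBall c r) := by
  have hboundary : Metric.closedBall c r \ interior (Metric.closedBall c r) =
      Metric.sphere c r := by
    rw [interior_closedBall c hr.ne', Metric.closedBall_sdiff_ball]
  refine ⟨(convex_closedBall c r).isConnected (Metric.nonempty_closedBall.2 hr.le), ?_, ?_⟩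
  · exact hboundary ▸ NormedSpace.sphere_nonempty.2 hr.le
  rw [hboundary]
  intro z hz
  have hzr : ‖z - c‖ = r := mem_sphere_iff_norm.1 hz
  have hderiv : HasFDerivAt (fun y => ‖y - c‖ ^ 2 - r ^ 2) (2 • innerSL ℝ (z - c)) z :=
    (((hasFDerivAt_id z).sub_const c).norm_sq).sub_const _
  refine ⟨univ, fun y => ‖y - c‖ ^ 2 - r ^ 2, isOpen_univ, mem_univ z, ContDiff.contMDiff
    (((contDiff_id.sub contDiff_const).norm_sq ℝ).sub contDiff_const) |>.contMDiffOn, ?_, ?_, ?_⟩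
  · simp only [hzr, sub_self]
  · rw [mfderiv_eq_fderiv, hderiv.fderiv]
    intro h
    have hzero : 2 • inner ℝ (z - c) (z - c) = 0 := DFunLike.congr_fun h (z - c)
    rw [real_inner_self_eq_norm_sq, hzr] at hzero
    exact (smul_pos two_pos (pow_pos hr 2)).ne' hzero
  · ext y
    simp [sq_le_sq₀ (norm_nonneg _) hr.le, dist_eq_norm]

variable {H : Type*} [TopologicalSpace H] {I : ModelWithCorners ℝ V H} [I.Boundaryless]
  {P : Type*} [TopologicalSpace P] [ChartedSpace H P]

/- The closed ball of which the segment from `χ x₀` to `χ x` is a diameter. -/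
theorem eventually_exists_isDomainWithBoundary [IsManifold I ∞ P] {x₀ : P} {U : Set P}
    (hU : U ∈ 𝓝 x₀) : ∀ᶠ x in 𝓝 x₀, x ≠ x₀ → ∃ N ⊆ U, IsDomainWithBoundary I N ∧
      x₀ ∈ N \ interior N ∧ x ∈ N \ interior N := by
  set χ := extChartAt I x₀
  have hχU : χ.target ∩ χ.symm ⁻¹' U ∈ 𝓝 (χ x₀) :=
    Filter.inter_mem (extChartAt_target_mem_nhds x₀)
      ((continuousAt_extChartAt_symm x₀).preimage_mem_nhds (by simpa using hU))
  obtain ⟨ε, hε, hεU⟩ := Metric.mem_nhds_iff.1 hχU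
  filter_upwards [extChartAt_source_mem_nhds (I := I) x₀,
    (continuousAt_extChartAt (I := I) x₀).preimage_mem_nhds (Metric.ball_mem_nhds _ hε)]
    with x hx hxε hne
  have hχne : χ x ≠ χ x₀ := χ.injOn.ne hx (mem_extChartAt_source x₀) hne
  have : Nontrivial V := ⟨_, _, hχne⟩
  have hr : 0 < dist (χ x) (χ x₀) / 2 := half_pos (dist_pos.2 hχne)
  set K := Metric.closedBall (midpoint ℝ (χ x) (χ x₀)) (dist (χ x) (χ x₀) / 2)
  have hKU : K ⊆ χ.target ∩ χ.symm ⁻¹' U := by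
    refine (Metric.closedBall_subset_ball' ?_).trans hεU
    rw [dist_midpoint_right, Real.norm_two, inv_mul_eq_div, add_halves]
    exact hxε
  have hKχ : K ⊆ χ.target := hKU.trans inter_subset_left
  have hboundary {y : P} (hy : y ∈ χ.source)
      (hyK : dist (χ y) (midpoint ℝ (χ x) (χ x₀)) = dist (χ x) (χ x₀) / 2) :
      y ∈ χ.symm '' K \ interior (χ.symm '' K) := by
    rw [image_extChartAt_symm_diff_interior hKχ]
    refine ⟨χ y, ?_, χ.left_inv hy⟩
    rw [interior_closedBall _ hr.ne', Metric.closedBall_sdiff_ball]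
    exact hyK
  refine ⟨χ.symm '' K, image_subset_iff.2 (hKU.trans inter_subset_right),
    (isDomainWithBoundary_closedBall _ hr).image_extChartAt_symm hKχ,
    hboundary (mem_extChartAt_source x₀) ?_, hboundary hx ?_⟩
  · rw [dist_right_midpoint, Real.norm_two, inv_mul_eq_div]
  · rw [dist_left_midpoint, Real.norm_two, inv_mul_eq_div]

end Domains

section LocalForm

variable {m n : ℕ} {M E : Type*} [TopologicalSpace M] [ChartedSpace (BaseModel m) M]
  [TopologicalSpace E] [ChartedSpace (TotModel m n) E]

theorem FibredManifold.contMDiff [IsManifold 𝓘(ℝ, BaseModel m) ∞ M]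
    [IsManifold 𝓘(ℝ, TotModel m n) ∞ E] (π : E → M) [FibredManifold m n π] :
    ContMDiff 𝓘(ℝ, TotModel m n) 𝓘(ℝ, BaseModel m) ∞ π := by
  intro u
  obtain ⟨φ, hφ, hu⟩ := FibredManifold.adapted (m := m) (n := n) (π := π)
    (chartAt (TotModel m n) u) (chart_mem_atlas _ u)
  have hu₀ := hu u (mem_chart_source (TotModel m n) u)
  have hfst : ContMDiffAt 𝓘(ℝ, TotModel m n) 𝓘(ℝ, BaseModel m) ∞
      (fun x => (chartAt (TotModel m n) u x).1) u :=
    (contDiff_fst.contMDiff (n := ∞)).contMDiffAt.comp u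
      ((contMDiffOn_chart (I := 𝓘(ℝ, TotModel m n))).contMDiffAt (chart_source_mem_nhds _ u))
  have hsymm : ContMDiffAt 𝓘(ℝ, BaseModel m) 𝓘(ℝ, BaseModel m) ∞ φ.symm
      (chartAt (TotModel m n) u u).1 :=
    (contMDiffOn_symm_of_mem_maximalAtlas hφ).contMDiffAt
      (φ.open_target.mem_nhds (hu₀.2 ▸ φ.map_source hu₀.1))
  refine (ContMDiffAt.comp u hsymm hfst).congr_of_eventuallyEq ?_
  filter_upwards [chart_source_mem_nhds (TotModel m n) u] with x hx
  simp only [Function.comp_apply, (hu x hx).2, φ.left_inv (hu x hx).1]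

variable [IsManifold 𝓘(ℝ, TotModel m n) ∞ E] {π : E → M} [FibredManifold m n π]

theorem contMDiff_projBase [IsManifold 𝓘(ℝ, BaseModel m) ∞ M] :
    ContMDiff (resModel m n) 𝓘(ℝ, BaseModel m) ∞ (projBase m n π) :=
  (FibredManifold.contMDiff π).comp (Bundle.contMDiff_proj _)

theorem inclForm_trivializationAt (q : ExtDual m n π) {x₀ : E}
    (hq : q.proj ∈ (chartAt (TotModel m n) x₀).source) :
    inclForm m n (trivializationAt (ExtFibre m n) (extCore m n π).Fiber x₀ q).2 =
      (toForm m n π q).compContinuousLinearMap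
        (mfderiv 𝓘(ℝ, TotModel m n) 𝓘(ℝ, TotModel m n)
          (extChartAt 𝓘(ℝ, TotModel m n) x₀).symm (extChartAt 𝓘(ℝ, TotModel m n) x₀ q.proj) :
            TotModel m n →L[ℝ] TotModel m n) := by
  have hsymmL := TangentBundle.symmL_trivializationAt (I := 𝓘(ℝ, TotModel m n)) hq
  rw [TangentBundle.symmL_trivializationAt_eq_core hq, ModelWithCorners.range_eq_univ,
    mfderivWithin_univ] at hsymmL
  have hvert := preservesVertical_coordChange m n π (achart (TotModel m n) x₀)
    (achart (TotModel m n) q.proj) hq (mem_chart_source _ _)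
  refine (pullExt_coe ((tangentBundleCore 𝓘(ℝ, TotModel m n) E).coordChange
    (achart (TotModel m n) x₀) (achart (TotModel m n) q.proj) q.proj) q.2).trans ?_
  rw [lowerTri_eq hvert]
  exact congrArg (ContinuousAlternatingMap.compContinuousLinearMap (toForm m n π q)) hsymmL

theorem extChartAt_resDual_symm (p : ResDual m n π) {y : TotModel m n × ResFibre m n}
    (hy : y ∈ (extChartAt (resModel m n) p).target) :
    ((extChartAt (resModel m n) p).symm y).proj =
        (extChartAt 𝓘(ℝ, TotModel m n) p.proj).symm y.1 ∧
      y.1 ∈ (extChartAt 𝓘(ℝ, TotModel m n) p.proj).target ∧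
      (trivializationAt (ResFibre m n) (resCore m n π).Fiber p.proj
        ((extChartAt (resModel m n) p).symm y)).2 = y.2 := by
  have htarget := hy
  rw [FiberBundle.extChartAt_target] at htarget
  obtain ⟨⟨hy₁, hy₂⟩, -⟩ := htarget
  have hsymm : (extChartAt (resModel m n) p).symm y =
      (trivializationAt (ResFibre m n) (resCore m n π).Fiber p.proj).toOpenPartialHomeomorph.symm
        ((extChartAt 𝓘(ℝ, TotModel m n) p.proj).symm y.1, y.2) := by
    rw [FiberBundle.extChartAt]
    rfl
  rw [hsymm]
  refine ⟨Bundle.Trivialization.proj_symm_apply' _ hy₂, hy₁, ?_⟩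
  rw [Bundle.Trivialization.apply_symm_apply' _ hy₂]

theorem mfderiv_proj_comp_mfderiv_extChartAt_symm (p : ResDual m n π)
    {y : TotModel m n × ResFibre m n} (hy : y ∈ (extChartAt (resModel m n) p).target) :
    (mfderiv (resModel m n) 𝓘(ℝ, TotModel m n) Bundle.TotalSpace.proj
        ((extChartAt (resModel m n) p).symm y)).comp
      (mfderiv 𝓘(ℝ, TotModel m n × ResFibre m n) (resModel m n)
        (extChartAt (resModel m n) p).symm y) =
      (mfderiv 𝓘(ℝ, TotModel m n) 𝓘(ℝ, TotModel m n)
        (extChartAt 𝓘(ℝ, TotModel m n) p.proj).symm y.1).comp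
        (ContinuousLinearMap.fst ℝ (TotModel m n) (ResFibre m n)) := by
  have hproj := ((Bundle.contMDiff_proj (n := ∞) (IB := 𝓘(ℝ, TotModel m n))
    (resCore m n π).Fiber _).mdifferentiableAt (by simp)).hasMFDerivAt.comp y
      (hasMFDerivAt_extChartAt_symm hy)
  have hfst := (hasMFDerivAt_extChartAt_symm (extChartAt_resDual_symm p hy).2.1).comp y
    (ContinuousLinearMap.fst ℝ (TotModel m n) (ResFibre m n)).hasFDerivAt.hasMFDerivAt
  refine hasMFDerivAt_unique hproj (hfst.congr_of_eventuallyEq ?_)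
  filter_upwards [(isOpen_extChartAt_target p).mem_nhds hy] with w hw
  exact (extChartAt_resDual_symm p hw).1

theorem mfderiv_proj_eq_fst (p : ResDual m n π) :
    mfderiv (resModel m n) 𝓘(ℝ, TotModel m n) Bundle.TotalSpace.proj p =
      ContinuousLinearMap.fst ℝ (TotModel m n) (ResFibre m n) := by
  have hproj := (mdifferentiableAt_extChartAt (I := 𝓘(ℝ, TotModel m n))
    (mem_chart_source _ p.proj)).hasMFDerivAt.comp p
    ((Bundle.contMDiff_proj (n := ∞) (resCore m n π).Fiber p).mdifferentiableAt
      (by simp)).hasMFDerivAt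
  have hfst := (ContinuousLinearMap.fst ℝ (TotModel m n) (ResFibre m n)).hasFDerivAt.hasMFDerivAt
    |>.comp p (mdifferentiableAt_extChartAt (I := resModel m n) (mem_chart_source _ p)).hasMFDerivAt
  have hchart : extChartAt 𝓘(ℝ, TotModel m n) p.proj ∘ Bundle.TotalSpace.proj =
      ContinuousLinearMap.fst ℝ (TotModel m n) (ResFibre m n) ∘ extChartAt (resModel m n) p := by
    funext q
    rw [FiberBundle.extChartAt]
    rfl
  have hderiv := hasMFDerivAt_unique hproj (hchart ▸ hfst)
  rw [mfderiv_extChartAt_self, mfderiv_extChartAt_self] at hderiv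
  exact hderiv

/-- The coordinate expression, near `p`, of a Hamiltonian section as a map between the models. -/
noncomputable def localSection (h : ResDual m n π → ExtDual m n π) (p : ResDual m n π)
    (y : TotModel m n × ResFibre m n) : ExtFibre m n :=
  (trivializationAt (ExtFibre m n) (extCore m n π).Fiber p.proj
    (h ((extChartAt (resModel m n) p).symm y))).2

variable {h : ResDual m n π → ExtDual m n π}

namespace IsHamiltonianSection

theorem proj_apply (hh : IsHamiltonianSection m n π h) (p : ResDual m n π) :
    (h p).proj = p.proj :=
  congrArg Bundle.TotalSpace.proj (hh.2 p)

theorem differentiableAt_localSection (hh : IsHamiltonianSection m n π h) (p : ResDual m n π) :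
    DifferentiableAt ℝ (localSection h p) (extChartAt (resModel m n) p p) := by
  have hsnd := (Bundle.contMDiffAt_totalSpace.1 (hh.1 p)).2
  rw [hh.proj_apply p] at hsnd
  exact (contDiffAt_comp_extChartAt_symm hsnd).differentiableAt (by simp)

theorem resMk_localSection (hh : IsHamiltonianSection m n π h) (p : ResDual m n π)
    {y : TotModel m n × ResFibre m n} (hy : y ∈ (extChartAt (resModel m n) p).target) :
    resMk m n (localSection h p y) = y.2 := by
  have hμ : resMk m n (localSection h p y) = (trivializationAt (ResFibre m n)
      (resCore m n π).Fiber p.proj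
        (quotientMap m n π (h ((extChartAt (resModel m n) p).symm y)))).2 := rfl
  rw [hμ, hh.2, (extChartAt_resDual_symm p hy).2.2]

theorem resMk_fderiv_localSection (hh : IsHamiltonianSection m n π h) (p : ResDual m n π)
    (w : TotModel m n × ResFibre m n) :
    resMk m n (fderiv ℝ (localSection h p) (extChartAt (resModel m n) p p) w) = w.2 := by
  have hres := (resMk m n).hasFDerivAt.comp _ (hh.differentiableAt_localSection p).hasFDerivAt
  have hsnd : resMk m n ∘ localSection h p =ᶠ[𝓝 (extChartAt (resModel m n) p p)]
      ContinuousLinearMap.snd ℝ (TotModel m n) (ResFibre m n) := by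
    filter_upwards [extChartAt_target_mem_nhds p] with y hy using hh.resMk_localSection p hy
  exact DFunLike.congr_fun (hres.unique
    ((ContinuousLinearMap.snd ℝ _ _).hasFDerivAt.congr_of_eventuallyEq hsnd)) w

theorem pullback_liouvilleForm (hh : IsHamiltonianSection m n π h) (z : ResDual m n π) :
    pullback (resModel m n) (extModel m n) h (liouvilleForm m n π) z =
      (toForm m n π (h z)).compContinuousLinearMap
        (mfderiv (resModel m n) 𝓘(ℝ, TotModel m n) Bundle.TotalSpace.proj z :
          TotModel m n × ResFibre m n →L[ℝ] TotModel m n) := by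
  have hproj := ((Bundle.contMDiff_proj (n := ∞) (IB := 𝓘(ℝ, TotModel m n)) (F := ExtFibre m n)
    (extCore m n π).Fiber (h z)).mdifferentiableAt (by simp)).hasMFDerivAt.comp z
      ((hh.1 z).mdifferentiableAt (by simp)).hasMFDerivAt
  have hcomp : Bundle.TotalSpace.proj ∘ h = Bundle.TotalSpace.proj := funext hh.proj_apply
  exact congrArg (ContinuousAlternatingMap.compContinuousLinearMap (toForm m n π (h z)))
    (hproj.mfderiv.symm.trans (by rw [hcomp]))

theorem pullback_liouvilleForm_extChartAt (hh : IsHamiltonianSection m n π h) (p : ResDual m n π)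
    {y : TotModel m n × ResFibre m n} (hy : y ∈ (extChartAt (resModel m n) p).target) :
    ((pullback (resModel m n) (extModel m n) h (liouvilleForm m n π)
      ((extChartAt (resModel m n) p).symm y)).compContinuousLinearMap
      (mfderiv 𝓘(ℝ, TotModel m n × ResFibre m n) (resModel m n)
        (extChartAt (resModel m n) p).symm y) :
          (TotModel m n × ResFibre m n) [⋀^Fin m]→L[ℝ] ℝ) =
      (inclForm m n (localSection h p y)).compContinuousLinearMap
        (ContinuousLinearMap.fst ℝ (TotModel m n) (ResFibre m n)) := by
  obtain ⟨hproj, hy₁, -⟩ := extChartAt_resDual_symm p hy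
  set z := (extChartAt (resModel m n) p).symm y
  have hhz : (h z).proj = (extChartAt 𝓘(ℝ, TotModel m n) p.proj).symm y.1 :=
    (hh.proj_apply z).trans hproj
  have hsource : (h z).proj ∈ (chartAt (TotModel m n) p.proj).source := by
    rw [hhz, ← extChartAt_source 𝓘(ℝ, TotModel m n)]
    exact (extChartAt 𝓘(ℝ, TotModel m n) p.proj).map_target hy₁
  have hincl := inclForm_trivializationAt (h z) hsource
  rw [hhz, (extChartAt 𝓘(ℝ, TotModel m n) p.proj).right_inv hy₁] at hincl
  rw [hh.pullback_liouvilleForm, localSection, hincl]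
  exact congrArg (ContinuousAlternatingMap.compContinuousLinearMap (toForm m n π (h z)))
    (mfderiv_proj_comp_mfderiv_extChartAt_symm p hy)

theorem extDiff_pullback_liouvilleForm (hh : IsHamiltonianSection m n π h) (p : ResDual m n π) :
    extDiff (resModel m n) (pullback (resModel m n) (extModel m n) h (liouvilleForm m n π)) p =
      ContinuousAlternatingMap.alternatizeUncurryFin
        ((ContinuousAlternatingMap.compContinuousLinearMapCLM
          (ContinuousLinearMap.fst ℝ (TotModel m n) (ResFibre m n))).comp
          ((inclForm m n).toContinuousLinearMap.comp
            (fderiv ℝ (localSection h p) (extChartAt (resModel m n) p p)))) := by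
  let c : (TotModel m n) [⋀^Fin m]→L[ℝ] ℝ →L[ℝ] (TotModel m n × ResFibre m n) [⋀^Fin m]→L[ℝ] ℝ :=
    ContinuousAlternatingMap.compContinuousLinearMapCLM
      (ContinuousLinearMap.fst ℝ (TotModel m n) (ResFibre m n))
  have hlocal := c.hasFDerivAt.comp (extChartAt (resModel m n) p p)
    ((inclForm m n).toContinuousLinearMap.hasFDerivAt.comp _
      (hh.differentiableAt_localSection p).hasFDerivAt)
  rw [extDiff, mfderiv_extChartAt_self]
  change extDerivWithin (𝕜 := ℝ) (E := TotModel m n × ResFibre m n) (F := ℝ) _ _ _ = _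
  rw [← hlocal.fderiv, ← extDeriv, ModelWithCorners.range_eq_univ, extDerivWithin_univ]
  refine Filter.EventuallyEq.extDeriv_eq ?_
  filter_upwards [extChartAt_target_mem_nhds (I := resModel m n) p] with y hy
  rw [mfderivWithin_univ]
  exact hh.pullback_liouvilleForm_extChartAt p hy

end IsHamiltonianSection

theorem alternatizeUncurryFin_apply_cons_of_fst_eq_zero {A B : Type*} [NormedAddCommGroup A]
    [NormedSpace ℝ A] [NormedAddCommGroup B] [NormedSpace ℝ B] {k : ℕ}
    (δ : A × B →L[ℝ] A [⋀^Fin k]→L[ℝ] ℝ) {w : A × B} (hw : w.1 = 0) (v : Fin k → A × B) :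
    ContinuousAlternatingMap.alternatizeUncurryFin
      ((ContinuousAlternatingMap.compContinuousLinearMapCLM (ContinuousLinearMap.fst ℝ A B)).comp δ)
      (Fin.cons w v) = δ w fun i => (v i).1 := by
  rw [ContinuousAlternatingMap.alternatizeUncurryFin_apply, Fin.sum_univ_succ,
    Finset.sum_eq_zero, add_zero]
  · simp [Function.comp_def]
  · intro i _
    obtain ⟨k, rfl⟩ := Nat.exists_eq_succ_of_ne_zero i.pos.ne'
    have hzero : δ (v i) (fun j =>
        (Fin.removeNth (α := fun _ => A × B) i.succ (Fin.cons w v) j).1) = 0 :=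
      (δ (v i)).map_coord_zero 0 (by simpa [Fin.removeNth] using hw)
    simpa [Function.comp_def] using hzero

theorem hamiltonCartan_apply_cons_of_vertical (hh : IsHamiltonianSection m n π h)
    {p : ResDual m n π} {w : TangentSpace (resModel m n) p}
    (hw : mfderiv (resModel m n) 𝓘(ℝ, TotModel m n) Bundle.TotalSpace.proj p w = 0)
    (v : Fin m → TangentSpace (resModel m n) p) :
    hamiltonCartan m n π h p (Fin.cons (α := fun _ => TangentSpace (resModel m n) p) w v) =
      -inclForm m n (fderiv ℝ (localSection h p) (extChartAt (resModel m n) p p) w)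
        (fun i => mfderiv (resModel m n) 𝓘(ℝ, TotModel m n) Bundle.TotalSpace.proj p (v i)) := by
  rw [mfderiv_proj_eq_fst] at hw ⊢
  rw [hamiltonCartan, hh.extDiff_pullback_liouvilleForm]
  exact congrArg Neg.neg (alternatizeUncurryFin_apply_cons_of_fst_eq_zero _ hw v)

theorem eq_zero_of_vertical_of_orthogonal (hh : IsHamiltonianSection m n π h) {p : ResDual m n π}
    {F : Submodule ℝ (TangentSpace (resModel m n) p)}
    (hF : ∀ a : TotModel m n, ∃ ξ ∈ F,
      mfderiv (resModel m n) 𝓘(ℝ, TotModel m n) Bundle.TotalSpace.proj p ξ = a)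
    {w : TangentSpace (resModel m n) p}
    (hw : mfderiv (resModel m n) 𝓘(ℝ, TotModel m n) Bundle.TotalSpace.proj p w = 0)
    (hort : w ∈ orthogonalComplement (resModel m n) (hamiltonCartan m n π h p) F) : w = 0 := by
  have hderiv : fderiv ℝ (localSection h p) (extChartAt (resModel m n) p p) w = 0 := by
    refine (inclForm m n).injective ?_
    rw [map_zero]
    ext a
    choose v hv hva using fun i => hF (a i)
    have happly := hort v hv
    rw [hamiltonCartan_apply_cons_of_vertical hh hw, neg_eq_zero] at happly
    exact (congrArg (inclForm m n _) (funext hva)).symm.trans happly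
  rw [mfderiv_proj_eq_fst] at hw
  refine Prod.ext hw ((hh.resMk_fderiv_localSection p w).symm.trans ?_)
  rw [hderiv, map_zero]
  rfl

end LocalForm

section HamiltonJacobi

variable {m n : ℕ} {M E : Type*} [TopologicalSpace M] [ChartedSpace (BaseModel m) M]
  [TopologicalSpace E] [ChartedSpace (TotModel m n) E]
  [IsManifold 𝓘(ℝ, TotModel m n) ∞ E] {π : E → M} [FibredManifold m n π]
  {h : ResDual m n π → ExtDual m n π} {D : Distribution (resModel m n) (ResDual m n π)}
  {s : DualSection m n π}

theorem mdifferentiable_resDual_proj : MDifferentiable (resModel m n) 𝓘(ℝ, TotModel m n)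
    (Bundle.TotalSpace.proj : ResDual m n π → E) :=
  (Bundle.contMDiff_proj _).mdifferentiable (n := ∞) (by simp)

theorem mfderiv_proj_mfderiv_toMap (s : DualSection m n π) (u : E)
    (a : TangentSpace 𝓘(ℝ, TotModel m n) u) :
    mfderiv (resModel m n) 𝓘(ℝ, TotModel m n) Bundle.TotalSpace.proj (s.toMap u)
      (mfderiv 𝓘(ℝ, TotModel m n) (resModel m n) s.toMap u a) = a :=
  DFunLike.congr_fun (hasMFDerivAt_unique
    ((mdifferentiable_resDual_proj (s.toMap u)).hasMFDerivAt.comp u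
      (s.mdifferentiable u).hasMFDerivAt) (hasMFDerivAt_id u)) a

theorem tangentImage_subset_orthogonalComplement
    (hs : pullback 𝓘(ℝ, TotModel m n) (resModel m n) s.toMap (hamiltonCartan m n π h) = 0)
    (u : E) :
    (tangentImage 𝓘(ℝ, TotModel m n) (resModel m n) s.toMap u : Set _) ⊆
      orthogonalComplement (resModel m n) (hamiltonCartan m n π h (s.toMap u))
        (tangentImage 𝓘(ℝ, TotModel m n) (resModel m n) s.toMap u) := by
  rintro _ ⟨a, rfl⟩ v hv
  choose b hb using hv
  refine Eq.trans (congrArg (hamiltonCartan m n π h (s.toMap u)) (funext fun i => ?_))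
    (DFunLike.congr_fun (congrFun hs u)
      (Fin.cons (α := fun _ => TangentSpace 𝓘(ℝ, TotModel m n) u) a b))
  exact Fin.cases rfl (fun i => (hb i).symm) i

theorem sub_mem_orthogonalComplement {p : ResDual m n π}
    {F : Submodule ℝ (TangentSpace (resModel m n) p)} {ξ η : TangentSpace (resModel m n) p}
    (hξ : ξ ∈ orthogonalComplement (resModel m n) (hamiltonCartan m n π h p) F)
    (hη : η ∈ orthogonalComplement (resModel m n) (hamiltonCartan m n π h p) F) :
    ξ - η ∈ orthogonalComplement (resModel m n) (hamiltonCartan m n π h p) F := by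
  intro v hv
  let Ω := (hamiltonCartan m n π h p).toContinuousMultilinearMap.toMultilinearMap
  have hadd := Ω.cons_add v (ξ - η) η
  have hξv : Ω (Fin.cons ξ v) = 0 := hξ v hv
  have hηv : Ω (Fin.cons η v) = 0 := hη v hv
  rw [sub_add_cancel, hξv, hηv, add_zero] at hadd
  exact hadd.symm

theorem isLagrangianImage_of_pullback_eq_zero (hh : IsHamiltonianSection m n π h)
    (hs : pullback 𝓘(ℝ, TotModel m n) (resModel m n) s.toMap (hamiltonCartan m n π h) = 0) :
    IsLagrangianImage 𝓘(ℝ, TotModel m n) (resModel m n) (hamiltonCartan m n π h) s.toMap := by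
  intro u
  have hiso := tangentImage_subset_orthogonalComplement hs u
  refine Subset.antisymm hiso fun ξ hξ => ?_
  set a : TangentSpace 𝓘(ℝ, TotModel m n) u :=
    mfderiv (resModel m n) 𝓘(ℝ, TotModel m n) Bundle.TotalSpace.proj (s.toMap u) ξ
  have htangent : mfderiv 𝓘(ℝ, TotModel m n) (resModel m n) s.toMap u a ∈
      tangentImage 𝓘(ℝ, TotModel m n) (resModel m n) s.toMap u := ⟨a, rfl⟩
  have hvertical : mfderiv (resModel m n) 𝓘(ℝ, TotModel m n) Bundle.TotalSpace.proj (s.toMap u)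
      (ξ - mfderiv 𝓘(ℝ, TotModel m n) (resModel m n) s.toMap u a) = 0 := by
    rw [map_sub]
    exact sub_eq_zero.2 (mfderiv_proj_mfderiv_toMap s u a).symm
  have hzero := eq_zero_of_vertical_of_orthogonal hh
    (F := tangentImage 𝓘(ℝ, TotModel m n) (resModel m n) s.toMap u)
    (fun b => ⟨_, ⟨b, rfl⟩, mfderiv_proj_mfderiv_toMap s u b⟩) hvertical
    (sub_mem_orthogonalComplement hξ (hiso htangent))
  rw [sub_eq_zero.1 hzero]
  exact htangent

theorem IsIntegralSection.proj {N : Set M} {ψ : M → ResDual m n π}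
    (hψ : IsIntegralSection 𝓘(ℝ, BaseModel m) (projBase m n π) D N ψ)
    (hs : ∀ x ∈ N, ∀ᶠ y in 𝓝 x, s.toMap (ψ y).proj = ψ y) :
    IsIntegralSection 𝓘(ℝ, BaseModel m) π (projectedDistribution s D) N fun x => (ψ x).proj := by
  have hmap {p q : ResDual m n π} (hpq : p = q) :
      ((D p).map (mfderiv (resModel m n) 𝓘(ℝ, TotModel m n) Bundle.TotalSpace.proj p :
        TangentSpace (resModel m n) p →ₗ[ℝ] TangentSpace 𝓘(ℝ, TotModel m n) p.proj) :
          Submodule ℝ (TotModel m n)) =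
      (D q).map (mfderiv (resModel m n) 𝓘(ℝ, TotModel m n) Bundle.TotalSpace.proj q :
        TangentSpace (resModel m n) q →ₗ[ℝ] TangentSpace 𝓘(ℝ, TotModel m n) q.proj) := by
    subst hpq
    rfl
  refine isIntegralSection_iff_eventually.2 fun x hx => ?_
  filter_upwards [hψ.eventually hx, hs x hx] with y ⟨hψy, hy, hDy⟩ hsy
  refine ⟨(Bundle.contMDiff_proj _).contMDiffAt.comp y hψy, hy, ?_⟩
  have hcomp := tangentImage_comp (mdifferentiable_resDual_proj (ψ y))
    (hψy.mdifferentiableAt (by simp))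
  rw [hDy] at hcomp
  exact hcomp.trans (hmap hsy.symm)

theorem IsTangentTo.map_projectedDistribution (hT : IsTangentTo D s) (u : E) :
    (projectedDistribution s D u).map (mfderiv 𝓘(ℝ, TotModel m n) (resModel m n) s.toMap u :
      TangentSpace 𝓘(ℝ, TotModel m n) u →ₗ[ℝ] TangentSpace (resModel m n) (s.toMap u)) =
      D (s.toMap u) := by
  refine Submodule.ext fun ξ => ⟨?_, fun hξ => ?_⟩
  · rintro ⟨_, ⟨ξ, hξ, rfl⟩, rfl⟩
    obtain ⟨a, rfl⟩ := hT u hξ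
    exact (congrArg (mfderiv 𝓘(ℝ, TotModel m n) (resModel m n) s.toMap u)
      (mfderiv_proj_mfderiv_toMap s u a)).symm ▸ hξ
  · obtain ⟨a, rfl⟩ := hT u hξ
    exact ⟨a, ⟨_, hξ, mfderiv_proj_mfderiv_toMap s u a⟩, rfl⟩

theorem IsTangentTo.isIntegralSection_toMap (hT : IsTangentTo D s) {N : Set M} {γ : M → E}
    (hγ : IsIntegralSection 𝓘(ℝ, BaseModel m) π (projectedDistribution s D) N γ) :
    IsIntegralSection 𝓘(ℝ, BaseModel m) (projBase m n π) D N fun x => s.toMap (γ x) := by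
  refine isIntegralSection_iff_eventually.2 fun x hx => ?_
  filter_upwards [hγ.eventually hx] with y ⟨hγy, hy, hDy⟩
  refine ⟨s.contMDiff.contMDiffAt.comp y hγy, hy, ?_⟩
  have hcomp := tangentImage_comp (s.mdifferentiable (γ y)) (hγy.mdifferentiableAt (by simp))
  rw [hDy] at hcomp
  exact hcomp.trans (hT.map_projectedDistribution (γ y))

theorem le_tangentImage_of_isIntegralSection_toMap {γ : M → E} {x : M} {u : E} (hu : γ x = u)
    (h : IsIntegralSection 𝓘(ℝ, BaseModel m) (projBase m n π) D {x} fun x => s.toMap (γ x))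
    (hγ : MDifferentiableAt 𝓘(ℝ, BaseModel m) 𝓘(ℝ, TotModel m n) γ x) :
    D (s.toMap u) ≤ tangentImage 𝓘(ℝ, TotModel m n) (resModel m n) s.toMap u := by
  subst hu
  rw [← h.tangentImage_eq rfl]
  refine (tangentImage_comp (s.mdifferentiable (γ x)) hγ).le.trans ?_
  rintro _ ⟨a, -, rfl⟩
  exact ⟨a, rfl⟩

theorem SolvesGeneralizedHJ.isTangentTo (hsol : SolvesGeneralizedHJ D s) : IsTangentTo D s := by
  intro u
  obtain ⟨γ, hγ, hu⟩ := hsol.1 u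
  obtain ⟨U, hU, hxU, hγU⟩ := hγ.exists_isOpen
  exact le_tangentImage_of_isIntegralSection_toMap hu ((hsol.2 U γ hU hγU).mono hxU)
    ((hγ.contMDiffAt rfl).mdifferentiableAt (by simp))

variable [IsManifold 𝓘(ℝ, BaseModel m) ∞ M]

theorem IsTangentTo.eventually_toMap_proj_eq (hT : IsTangentTo D s) (hD : IsSmoothOfRank m D)
    (htr : IsTransverse 𝓘(ℝ, BaseModel m) (projBase m n π) D) {x : M} {ψ : M → ResDual m n π}
    (hψ : IsIntegralSection 𝓘(ℝ, BaseModel m) (projBase m n π) D {x} ψ)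
    (hx : s.toMap (ψ x).proj = ψ x) : ∀ᶠ y in 𝓝 x, s.toMap (ψ y).proj = ψ y := by
  refine hψ.eventually_isFixedPt (S := fun q => s.toMap q.proj) contMDiff_projBase
    (by rwa [finrank_euclideanSpace_fin]) htr (s.contMDiff.comp (Bundle.contMDiff_proj _))
    (fun _ => rfl) (fun q ξ hξ => ?_) hx
  obtain ⟨a, rfl⟩ := hT q.proj hξ
  have hcomp := tangentImage_comp (s.mdifferentiable q.proj) (mdifferentiable_resDual_proj q)
  refine hcomp.ge ⟨a, ⟨((a, 0) : TotModel m n × ResFibre m n), ?_⟩, rfl⟩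
  exact DFunLike.congr_fun (mfderiv_proj_eq_fst q) ((a, 0) : TotModel m n × ResFibre m n)

theorem IsTangentTo.isIntegrable_projectedDistribution (hT : IsTangentTo D s)
    (hD : IsSmoothOfRank m D) (htr : IsTransverse 𝓘(ℝ, BaseModel m) (projBase m n π) D)
    (hint : IsIntegrable 𝓘(ℝ, BaseModel m) (projBase m n π) D) :
    IsIntegrable 𝓘(ℝ, BaseModel m) π (projectedDistribution s D) := by
  intro u
  obtain ⟨ψ, hψ, hψu⟩ := hint (s.toMap u)
  change ψ (π u) = s.toMap u at hψu
  have hfix : s.toMap (ψ (π u)).proj = ψ (π u) := by rw [hψu]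
  refine ⟨fun x => (ψ x).proj, hψ.proj ?_, congrArg Bundle.TotalSpace.proj hψu⟩
  rintro _ rfl
  exact hT.eventually_toMap_proj_eq hD htr hψ hfix

theorem IsTangentTo.boundarySectionsProjectOnto [T2Space E] (hT : IsTangentTo D s)
    (hD : IsSmoothOfRank m D) (htr : IsTransverse 𝓘(ℝ, BaseModel m) (projBase m n π) D)
    (hint : IsIntegrable 𝓘(ℝ, BaseModel m) (projBase m n π) D) :
    BoundarySectionsProjectOnto D s := by
  have : T2Space (ResDual m n π) := t2Space_totalSpace
  refine ⟨hT.isIntegrable_projectedDistribution hD htr hint, fun N hN => ⟨fun ψ hψ hbd => ?_,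
    fun γ hγ => ⟨_, hT.isIntegralSection_toMap hγ, fun x _ => mem_range_self _, fun _ _ => rfl⟩⟩⟩
  obtain ⟨x, hx⟩ := hN.boundary_nonempty
  have hxs : s.toMap (ψ x).proj = ψ x := by
    obtain ⟨u, hu⟩ := hbd x hx
    rw [← hu]
  have hstay : EqOn (fun y => s.toMap (ψ y).proj) ψ N :=
    eqOn_of_isPreconnected_of_eventuallyEq hN.connected.isPreconnected
      (fun y hy => (s.contMDiff.comp (Bundle.contMDiff_proj _)).continuous.continuousAt.comp
        (hψ.contMDiffAt hy).continuousAt)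
      (fun y hy => (hψ.contMDiffAt hy).continuousAt)
      (fun y hy => hT.eventually_toMap_proj_eq hD htr (hψ.singleton hy)) hx.1 hxs
  exact hψ.proj fun y hy => hT.eventually_toMap_proj_eq hD htr (hψ.singleton hy) (hstay hy)

theorem BoundarySectionsProjectOnto.eventuallyEq_toMap [T2Space E]
    (hb : BoundarySectionsProjectOnto D s) (hD : IsSmoothOfRank m D)
    (htr : IsTransverse 𝓘(ℝ, BaseModel m) (projBase m n π) D) {x₀ : M} {γ : M → E}
    (hγ : IsIntegralSection 𝓘(ℝ, BaseModel m) π (projectedDistribution s D) {x₀} γ)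
    {ψ : M → ResDual m n π}
    (hψ : IsIntegralSection 𝓘(ℝ, BaseModel m) (projBase m n π) D {x₀} ψ)
    (hψγ : ψ x₀ = s.toMap (γ x₀)) : (fun x => s.toMap (γ x)) =ᶠ[𝓝 x₀] ψ := by
  have : T2Space (ResDual m n π) := t2Space_totalSpace
  obtain ⟨U, hU, hxU, hγU⟩ := hγ.exists_isOpen
  obtain ⟨W, hW, hxW, hψW⟩ := hψ.exists_isOpen
  filter_upwards [eventually_exists_isDomainWithBoundary (I := 𝓘(ℝ, BaseModel m))
    ((hU.inter hW).mem_nhds ⟨hxU rfl, hxW rfl⟩)] with x hx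
  rcases eq_or_ne x x₀ with rfl | hne
  · exact hψγ.symm
  obtain ⟨N, hNUW, hN, hx₀N, hxN⟩ := hx hne
  obtain ⟨ψ', hψ', hbd, hproj⟩ := (hb.2 N hN).2 γ (hγU.mono (hNUW.trans inter_subset_left))
  have hboundary {y : M} (hy : y ∈ N \ interior N) : ψ' y = s.toMap (γ y) := by
    obtain ⟨u, hu⟩ := hbd y hy
    rw [← hproj y hy.1, ← hu]
  have heq : EqOn ψ' ψ N := hψ'.eqOn contMDiff_projBase (by rwa [finrank_euclideanSpace_fin]) htr
    hN.connected.isPreconnected (hψW.mono (hNUW.trans inter_subset_right)) hx₀N.1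
    ((hboundary hx₀N).trans hψγ.symm)
  rw [← heq hxN.1, hboundary hxN]

theorem BoundarySectionsProjectOnto.isTangentTo [T2Space E] (hb : BoundarySectionsProjectOnto D s)
    (hD : IsSmoothOfRank m D) (htr : IsTransverse 𝓘(ℝ, BaseModel m) (projBase m n π) D)
    (hint : IsIntegrable 𝓘(ℝ, BaseModel m) (projBase m n π) D) : IsTangentTo D s := by
  intro u
  obtain ⟨γ, hγ, hu⟩ := hb.1 u
  obtain ⟨ψ, hψ, hψu⟩ := hint (s.toMap u)
  have heq := hb.eventuallyEq_toMap hD htr hγ hψ (hψu.trans (congrArg s.toMap hu.symm))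
  refine le_tangentImage_of_isIntegralSection_toMap hu (hψ.congr ?_)
    ((hγ.contMDiffAt rfl).mdifferentiableAt (by simp))
  rintro _ rfl
  exact heq

end HamiltonJacobi

end HJ

theorem mainTheorem5_general {m n : ℕ} {M E : Type*}
    [TopologicalSpace M] [ChartedSpace (HJ.BaseModel m) M] [IsManifold 𝓘(ℝ, HJ.BaseModel m) ∞ M]
    [TopologicalSpace E] [T2Space E] [ChartedSpace (HJ.TotModel m n) E]
    [IsManifold 𝓘(ℝ, HJ.TotModel m n) ∞ E] (π : E → M) [HJ.FibredManifold m n π]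
    (h : HJ.ResDual m n π → HJ.ExtDual m n π) (hh : HJ.IsHamiltonianSection m n π h)
    (D : HJ.Distribution (HJ.resModel m n) (HJ.ResDual m n π))
    (hD : HJ.IsSmoothOfRank m D)
    (htr : HJ.IsTransverse 𝓘(ℝ, HJ.BaseModel m) (HJ.projBase m n π) D)
    (hint : HJ.IsIntegrable 𝓘(ℝ, HJ.BaseModel m) (HJ.projBase m n π) D)
    (s : HJ.DualSection m n π)
    (hs : HJ.pullback 𝓘(ℝ, HJ.TotModel m n) (HJ.resModel m n) s.toMap
      (HJ.hamiltonCartan m n π h) = 0) :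
    List.TFAE [
      HJ.SolvesHJ h D s,
      HJ.IsLagrangianImage 𝓘(ℝ, HJ.TotModel m n) (HJ.resModel m n)
        (HJ.hamiltonCartan m n π h) s.toMap ∧ HJ.IsTangentTo D s,
      HJ.BoundarySectionsProjectOnto D s] := by
  have hLag := HJ.isLagrangianImage_of_pullback_eq_zero hh hs
  tfae_have 1 → 2 := fun hsol => ⟨hLag, hsol.1.isTangentTo⟩
  tfae_have 2 → 1 := fun ⟨_, hT⟩ =>
    ⟨⟨hT.isIntegrable_projectedDistribution hD htr hint,
      fun _ _ _ hγ => hT.isIntegralSection_toMap hγ⟩, hs⟩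
  tfae_have 2 → 3 := fun ⟨_, hT⟩ => hT.boundarySectionsProjectOnto hD htr hint
  tfae_have 3 → 2 := fun hb => ⟨hLag, hb.isTangentTo hD htr hint⟩
  tfae_finish

theorem mainTheorem5 {m n : ℕ} (hm : 1 ≤ m)
    {M E : Type*}
    [TopologicalSpace M] [T2Space M] [SecondCountableTopology M]
    [ChartedSpace (HJ.BaseModel m) M] [IsManifold 𝓘(ℝ, HJ.BaseModel m) ∞ M]
    [TopologicalSpace E] [T2Space E] [SecondCountableTopology E]
    [ChartedSpace (HJ.TotModel m n) E] [IsManifold 𝓘(ℝ, HJ.TotModel m n) ∞ E]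
    (π : E → M) [HJ.FibredManifold m n π]
    (h : HJ.ResDual m n π → HJ.ExtDual m n π) (hh : HJ.IsHamiltonianSection m n π h)
    (D : HJ.Distribution (HJ.resModel m n) (HJ.ResDual m n π))
    (hD : HJ.IsHamiltonianDistribution m n π h D)
    (s : HJ.DualSection m n π)
    (hs : HJ.pullback 𝓘(ℝ, HJ.TotModel m n) (HJ.resModel m n) s.toMap
      (HJ.hamiltonCartan m n π h) = 0) :
    List.TFAE [
      HJ.SolvesHJ h D s,
      HJ.IsLagrangianImage 𝓘(ℝ, HJ.TotModel m n) (HJ.resModel m n)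
        (HJ.hamiltonCartan m n π h) s.toMap ∧ HJ.IsTangentTo D s,
      HJ.BoundarySectionsProjectOnto D s] :=
  mainTheorem5_general π h hh D hD.smooth hD.transverse hD.integrable s hs
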